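/- For an open set $U\subset\mathbb{R}^3$, $C^{1,\beta}(U)$ denotes the $C^1$ functions on $U$ whose gradient is locally $\beta$-Hölder continuous. Let $0<\beta\le 1$. There is a constant $C$ depending only on $\beta$ with the following property. Let $b>0$, $\theta>0$, $R\geq 0$ with $$R^\beta b\le\theta,$$ and let $\Sigma_1,\Sigma_2,\Sigma_3\subset\mathbb{R}^3$ be nonempty bounded sets with $\operatorname{diam}\Sigma_i\le R$ such that, for $i=1,2,3$, $\Sigma_i$ is a relatively open subset of an oriented surface $\Sigma_i^*$ with continuous unit normal field $\mathfrak n_i$, where: 1. $\Sigma_i^*=\{\sigma\in U_i:\Phi_i(\sigma)=0\}$ for a convex open set $U_i\subset\mathbb{R}^3$ with $\operatorname{dist}(\Sigma_i,U_i^c)\ge\operatorname{diam}(\Sigma_i)$ and a function $\Phi_i\in C^{1,\beta}(U_i)$ with $\nabla\Phi_i\ne0$ on $\Sigma_i^*$; 2. for all $\sigma\neq\tilde\sigma$ in $\Sigma_i^*$, $$\frac{|\mathfrak n_i(\sigma)-\mathfrak n_i(\tilde\sigma)|}{|\sigma-\tilde\sigma|^\beta}+\frac{|\mathfrak n_i(\sigma)\cdot(\sigma-\tilde\sigma)|}{|\sigma-\tilde\sigma|^{1+\beta}}\le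 b;$$ 3. for all $(\sigma_1,\sigma_2,\sigma_3)\in\Sigma_1^*\times\Sigma_2^*\times\Sigma_3^*$, $$\theta\le\det\big(\mathfrak n_1(\sigma_1),\mathfrak n_2(\sigma_2),\mathfrak n_3(\sigma_3)\big)\le1.$$ Let $\mu_i$ be the surface measure on $\Sigma_i$, $L^2(\Sigma_i)=L^2(\Sigma_i,\mu_i;\mathbb{C})$, and let $C_c(\Sigma_i)$ be the continuous complex functions on $\Sigma_i$ with compact support. For $\varphi\in C_c(\Sigma_1)$ and $\gamma\in C_c(\Sigma_2)$ let $\varphi*\gamma$ be the distribution $$(\varphi*\gamma)(\psi)=\int_{\Sigma_1}\int_{\Sigma_2}\varphi(x)\gamma(y)\psi(x+y)\,d\mu_2(y)\,d\mu_1(x),\qquad\psi\in C_c^\infty(\mathbb{R}^3).$$ Then $\varphi*\gamma$ is given by a continuous compactly supported function on $\mathbb{R}^3$, for all such $\varphi,\gamma$. Moreover, for each $f\in L^2(\Sigma_1)$ and $g\in L^2(\Sigma_2)$ the restriction of $f*g$ to $\Sigma_3$ is a well-defined element of $L^2(\Sigma_3)$, in the sense that there is exactly one $h\in L^2(\Sigma_3)$,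 denoted $(f*g)|_{\Sigma_3}$, such that $(\varphi_k*\gamma_k)|_{\Sigma_3}\to h$ in $L^2(\Sigma_3)$ whenever $\varphi_k\in C_c(\Sigma_1)$, $\gamma_k\in C_c(\Sigma_2)$, $\varphi_k\to f$ in $L^2(\Sigma_1)$ and $\gamma_k\to g$ in $L^2(\Sigma_2)$; and it satisfies $$\|f*g\|_{L^2(\Sigma_3)}\le\frac{C}{\sqrt\theta}\,\|f\|_{L^2(\Sigma_1)}\|g\|_{L^2(\Sigma_2)}.$$ -/

import Mathlib

open MeasureTheory Set Filter Topology
open scoped ContDiff CompactlySupported ENNReal RealInnerProductSpace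

/-- Euclidean space `ℝ³`. -/
abbrev E3 : Type := EuclideanSpace ℝ (Fin 3)

/-- `Φ ∈ C^{1,β}(U)` for an open set `U`: continuously differentiable with (locally)
`β`-Hölder continuous gradient. -/
def IsC1Holder (β : ℝ) (Φ : E3 → ℝ) (U : Set E3) : Prop :=
  ContDiffOn ℝ 1 Φ U ∧
    ∀ x ∈ U, ∃ V ∈ 𝓝 x, ∃ K : ℝ, ∀ y ∈ U ∩ V, ∀ z ∈ U ∩ V,
      ‖gradient Φ y - gradient Φ z‖ ≤ K * ‖y - z‖ ^ β

/-- `S` is a nonempty bounded open piece of the oriented `C^{1,β}` surface `Sstar`, whose unit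
normal field is `n`. The larger surface is a regular level set `{Φ = 0}` in a convex open set `U`
with `dist (S, Uᶜ) ≥ diam S`, and the Hölder condition with constant `b` holds on `Sstar`. -/
structure IsHolderSurface (β b : ℝ) (S Sstar : Set E3) (n : E3 → E3) : Prop where
  nonempty : S.Nonempty
  bounded : Bornology.IsBounded S
  subset : S ⊆ Sstar
  relOpen : ∃ O : Set E3, IsOpen O ∧ S = Sstar ∩ O
  /-- The level set representation, and `n` is a unit normal field on `Sstar`. -/
  levelSet : ∃ (U : Set E3) (Φ : E3 → ℝ),
    IsOpen U ∧ Convex ℝ U ∧ (∀ x ∈ S, ∀ y ∉ U, Metric.diam S ≤ dist x y) ∧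
    IsC1Holder β Φ U ∧ Sstar = {x | x ∈ U ∧ Φ x = 0} ∧
    (∀ x ∈ Sstar, gradient Φ x ≠ 0) ∧
    (∀ x ∈ Sstar, ‖n x‖ = 1 ∧ ∃ c : ℝ, n x = c • gradient Φ x)
  continuous_normal : ContinuousOn n Sstar
  holder : ∀ x ∈ Sstar, ∀ y ∈ Sstar, x ≠ y →
    ‖n x - n y‖ / ‖x - y‖ ^ β + |⟪n x, x - y⟫| / ‖x - y‖ ^ (1 + β) ≤ b

/-- Three surfaces which are `C^{1,β}` with Hölder constant `b` and transversal with
constant `θ`. The matrix has the unit normals `n₁(x₁), n₂(x₂), n₃(x₃)` as its columns. -/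
def TransversalSurfaces (β b θ : ℝ) (S : Fin 3 → Set E3) : Prop :=
  ∃ (Sstar : Fin 3 → Set E3) (n : Fin 3 → E3 → E3),
    (∀ i, IsHolderSurface β b (S i) (Sstar i) (n i)) ∧
    ∀ x : Fin 3 → E3, (∀ i, x i ∈ Sstar i) →
      θ ≤ (Matrix.of fun k i : Fin 3 => n i (x i) k).det ∧
      (Matrix.of fun k i : Fin 3 => n i (x i) k).det ≤ 1

/-- The surface measure on `S`: the two-dimensional Hausdorff measure of the metric space `S`
(with the Euclidean distance), normalized to give Lebesgue measure on planes. -/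
noncomputable def surfaceMeasure (S : Set E3) : Measure S :=
  Measure.euclideanHausdorffMeasure 2

/-- The function `F` represents the distribution `f ∗ g`, that is,
`∫ F ψ = ∫_{S₁} ∫_{S₂} f(x) g(y) ψ(x + y) dμ₂(y) dμ₁(x)` for all test functions `ψ`. -/
def RepresentsConvolution {S₁ S₂ : Set E3} (f : S₁ → ℂ) (g : S₂ → ℂ) (F : E3 → ℂ) : Prop :=
  ∀ ψ : E3 → ℂ, ContDiff ℝ ∞ ψ → HasCompactSupport ψ →
    ∫ z, F z * ψ z =
      ∫ x, ∫ y, f x * g y * ψ ((x : E3) + (y : E3)) ∂(surfaceMeasure S₂) ∂(surfaceMeasure S₁)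

/-- `h ∈ L²(S₃)` is the restriction to `S₃` of the convolution of `f ∈ L²(S₁)` and `g ∈ L²(S₂)`,
defined by density: whenever `φ k → f` and `γ k → g` in `L²` with `φ k`, `γ k` continuous and
compactly supported on `S₁`, `S₂`, and `F k` is the continuous function `φ k ∗ γ k`,
the pointwise restrictions of `F k` to `S₃` converge to `h` in `L²(S₃)`. -/
def IsConvolutionTrace {S₁ S₂ S₃ : Set E3}
    (f : Lp ℂ 2 (surfaceMeasure S₁)) (g : Lp ℂ 2 (surfaceMeasure S₂))
    (h : Lp ℂ 2 (surfaceMeasure S₃)) : Prop :=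
  ∀ (φ : ℕ → C_c(S₁, ℂ)) (γ : ℕ → C_c(S₂, ℂ)) (F : ℕ → C_c(E3, ℂ)),
    Tendsto (fun k => eLpNorm (fun x => φ k x - f x) 2 (surfaceMeasure S₁)) atTop (𝓝 0) →
    Tendsto (fun k => eLpNorm (fun y => γ k y - g y) 2 (surfaceMeasure S₂)) atTop (𝓝 0) →
    (∀ k, RepresentsConvolution (φ k) (γ k) (F k)) →
    Tendsto (fun k => eLpNorm (fun z : S₃ => F k (z : E3) - h z) 2 (surfaceMeasure S₃))
      atTop (𝓝 0)

/-! The estimate is first proved for continuous compactly supported f and g, by thickening the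
surfaces. Let η be a mollifier at scale ε. Mollifying f * g gives the double integral of f(x) g(y)
η(z - x - y). Cauchy–Schwarz with weight η and integration over z in `S 2` bound its squared L² norm
by ‖f‖² ‖g‖² times the supremum over x, y of the integral of D₁(z - x) D₀(z - y) over `S 2`, where
Dᵢ is the mollified surface measure of `S i` (`lintegral_sq_convolution_le`). A ball of radius ε
meets `S i` in area O(ε²), so Dᵢ is O(1/ε), and it vanishes at distance ε or more from `S i`. It
remains to show that the points of `S 2` that are ε-close to both x + `S 1` and y + `S 0` have area
O(ε²/θ) (`exists_measure_nearSumSet_le`): a quantitative form of the fact that three transversal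
surfaces meet in isolated points.

For this, `S 2` is cut into cells, their number depending only on β, with b · diam^β ≤ θ/24. The
difference v of two such points in one cell is almost orthogonal to a normal of each surface, while
θ‖v‖ ≤ ∑ |⟨nᵢ, v⟩|; the Hölder errors are absorbed and ‖v‖ = O(ε/θ). At this scale, for small ε,
curvature is negligible and the points lie in three slabs of width O(ε). Because the determinant is
at least θ, the projection of the slabs' intersection to a tangent plane has area O(ε²/θ), one power
of θ better than the diameter alone gives (`measure_cluster_le`). Fatou's lemma lets ε tend to 0.

Continuity of f * g is a local matter. Transversality makes addition a submersion from `S 0` × `S 1`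
to ℝ³; completed by one linear functional it is a local C¹ diffeomorphism (`exists_sum_chart`). All
measures involved have continuous densities in these coordinates, and integrating out the extra
variable leaves a continuous function. A partition of unity globalizes this
(`hasSumDensity_of_locally`), and bilinearity with density of C_c extends the restriction to L²
(`exists_convolutionTrace`). -/

open scoped NNReal

/-! ### Continuous densities from local comparison of measures -/

/-- A measure that is locally dominated by another one is dominated by it. -/
theorem measure_le_of_locally_le {E : Type*} [TopologicalSpace E] [SecondCountableTopology E]
    [MeasurableSpace E] [BorelSpace E] (m₁ m₂ : Measure E) {T : Set E}
    (h : ∀ w ∈ T, ∃ V ∈ 𝓝 w, ∀ B ⊆ V, MeasurableSet B → m₁ B ≤ m₂ B) :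
    ∀ B ⊆ T, MeasurableSet B → m₁ B ≤ m₂ B := by
  intro B hBT hB
  choose! V hV hVB using h
  obtain ⟨t, htT, htc, hcov⟩ :=
    TopologicalSpace.countable_cover_nhdsWithin (s := T) (f := fun w => interior (V w))
      (fun w hw => mem_nhdsWithin_of_mem_nhds (interior_mem_nhds.2 (hV w hw)))
  rcases B.eq_empty_or_nonempty with rfl | hne
  · simp
  have htne : t.Nonempty := by
    by_contra hcon
    rw [not_nonempty_iff_eq_empty] at hcon
    subst hcon
    obtain ⟨x, hx⟩ := hne
    simpa using hcov (hBT hx)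
  obtain ⟨f, hf⟩ := htc.exists_eq_range htne
  set D : ℕ → Set E := disjointed fun n => interior (V (f n)) with hD
  have hDm : ∀ n, MeasurableSet (D n) :=
    fun n => MeasurableSet.disjointed (fun k => isOpen_interior.measurableSet) n
  have hBD : B = ⋃ n, B ∩ D n := by
    rw [← inter_iUnion, iUnion_disjointed]
    refine (inter_eq_left.2 fun x hx => ?_).symm
    have := hcov (hBT hx)
    rw [hf] at this
    simpa using this
  have hdisj : Pairwise (Function.onFun Disjoint fun n => B ∩ D n) := fun i j hij =>
    ((disjoint_disjointed _) hij).mono inter_subset_right inter_subset_right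
  rw [hBD, measure_iUnion hdisj fun n => hB.inter (hDm n),
    measure_iUnion hdisj fun n => hB.inter (hDm n)]
  refine ENNReal.tsum_le_tsum fun n => hVB (f n) (htT (hf ▸ mem_range_self n)) _ ?_ (hB.inter (hDm n))
  exact inter_subset_right.trans ((disjointed_subset _ n).trans interior_subset)

theorem ENNReal.le_of_forall_one_lt_le_mul {x y : ℝ≥0∞} (h : ∀ r : ℝ≥0, 1 < r → x ≤ r * y) :
    x ≤ y := by
  have h1 : Tendsto (fun r : ℝ≥0 => (r : ℝ≥0∞) * y) (𝓝[>] 1) (𝓝 ((1 : ℝ≥0) * y)) := by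
    rcases eq_or_ne y ⊤ with rfl | hy
    · refine tendsto_const_nhds.congr' ?_
      filter_upwards [self_mem_nhdsWithin] with r hr
      rw [ENNReal.mul_top, ENNReal.mul_top]
      · exact ENNReal.coe_ne_zero.2 (zero_lt_one.trans (mem_Ioi.1 hr)).ne'
      · exact ENNReal.coe_ne_zero.2 one_ne_zero
    · exact (ENNReal.Tendsto.mul_const (ENNReal.tendsto_coe.2 tendsto_id) (Or.inr hy)).mono_left
        nhdsWithin_le_nhds
  rw [ENNReal.coe_one, one_mul] at h1
  exact ge_of_tendsto h1 (by filter_upwards [self_mem_nhdsWithin] with r hr using h r hr)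

/-- If two measures are asymptotically proportional at every point of an open set, then
the proportionality factor is continuous and is the density of the one with respect to the other. -/
theorem exists_continuousOn_density {E : Type*} [TopologicalSpace E] [SecondCountableTopology E]
    [MeasurableSpace E] [BorelSpace E] (m ν : Measure E) [ν.IsOpenPosMeasure]
    [IsLocallyFiniteMeasure ν] {T : Set E} (hT : IsOpen T)
    (h : ∀ w ∈ T, ∃ c : ℝ≥0, ∀ r : ℝ≥0, 1 < r → ∃ V ∈ 𝓝 w, ∀ B ⊆ V, MeasurableSet B →
      m B ≤ r * (c * ν B) ∧ c * ν B ≤ r * m B) :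
    ∃ k : E → ℝ≥0, ContinuousOn k T ∧
      m.restrict T = (ν.restrict T).withDensity fun w => (k w : ℝ≥0∞) := by
  choose! c hc using h
  -- The constants at two nearby points are compared on a common open set of positive finite
  -- ν-measure, which can be cancelled.
  have hloc : ∀ w₀ ∈ T, ∀ r : ℝ≥0, 1 < r →
      ∀ᶠ w in 𝓝 w₀, c w ≤ r ^ 2 * c w₀ ∧ c w₀ ≤ r ^ 2 * c w := by
    intro w₀ hw₀ r hr
    obtain ⟨V, hV, hVB⟩ := hc w₀ hw₀ r hr
    filter_upwards [interior_mem_nhds.2 hV, hT.mem_nhds hw₀] with w hwV hwT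
    obtain ⟨V', hV', hVB'⟩ := hc w hwT r hr
    obtain ⟨U, hU, hUo, hUfin⟩ := ν.exists_isOpen_measure_lt_top w
    set A := interior V ∩ interior V' ∩ U
    have hAo : IsOpen A := (isOpen_interior.inter isOpen_interior).inter hUo
    have hwA : w ∈ A := ⟨⟨hwV, mem_interior_iff_mem_nhds.2 hV'⟩, hU⟩
    have h0 : ν A ≠ 0 := (hAo.measure_pos ν ⟨w, hwA⟩).ne'
    have htop : ν A ≠ ⊤ := ((measure_mono inter_subset_right).trans_lt hUfin).ne
    obtain ⟨h1, h2⟩ := hVB A (fun x hx => interior_subset hx.1.1) hAo.measurableSet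
    obtain ⟨h3, h4⟩ := hVB' A (fun x hx => interior_subset hx.1.2) hAo.measurableSet
    constructor
    · have : (c w : ℝ≥0∞) * ν A ≤ (r ^ 2 * c w₀ : ℝ≥0) * ν A := by
        calc (c w : ℝ≥0∞) * ν A ≤ r * m A := h4
          _ ≤ r * (r * (c w₀ * ν A)) := by gcongr
          _ = _ := by push_cast; ring
      exact_mod_cast (ENNReal.mul_le_mul_iff_left h0 htop).1 this
    · have : (c w₀ : ℝ≥0∞) * ν A ≤ (r ^ 2 * c w : ℝ≥0) * ν A := by
        calc (c w₀ : ℝ≥0∞) * ν A ≤ r * m A := h2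
          _ ≤ r * (r * (c w * ν A)) := by gcongr
          _ = _ := by push_cast; ring
      exact_mod_cast (ENNReal.mul_le_mul_iff_left h0 htop).1 this
  have hpick : ∀ a b : ℝ≥0, a < b → ∃ r : ℝ≥0, 1 < r ∧ r ^ 2 * a < b := by
    intro a b hab
    have h1 : Tendsto (fun r : ℝ≥0 => r ^ 2 * a) (𝓝[>] 1) (𝓝 (1 ^ 2 * a)) :=
      ((continuous_id.pow 2).mul continuous_const).continuousAt.mono_left nhdsWithin_le_nhds
    rw [one_pow, one_mul] at h1
    obtain ⟨r, hr1, hr2⟩ := ((h1.eventually_lt_const hab).and self_mem_nhdsWithin).exists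
    exact ⟨r, hr2, hr1⟩
  refine ⟨c, fun w₀ hw₀ => ContinuousAt.continuousWithinAt ?_, ?_⟩
  · refine tendsto_order.2 ⟨fun a ha => ?_, fun a ha => ?_⟩
    · obtain ⟨r, hr, hra⟩ := hpick a _ ha
      filter_upwards [hloc w₀ hw₀ r hr] with w hw
      exact lt_of_mul_lt_mul_left (hra.trans_le hw.2) (zero_le)
    · obtain ⟨r, hr, hra⟩ := hpick _ a ha
      filter_upwards [hloc w₀ hw₀ r hr] with w hw
      exact hw.1.trans_lt hra
  set m₂ : Measure E := ν.withDensity fun w => (c w : ℝ≥0∞)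
  -- One factor `r` comes from the local comparison of `m` with `c w * ν`, and `r ^ 2` from the
  -- variation of `c` near `w`.
  have key : ∀ r : ℝ≥0, 1 < r → ∀ B ⊆ T, MeasurableSet B →
      m B ≤ (r ^ 3 : ℝ≥0) * m₂ B ∧ m₂ B ≤ (r ^ 3 : ℝ≥0) * m B := by
    intro r hr
    have hbd : ∀ w ∈ T, ∃ V ∈ 𝓝 w, ∀ B ⊆ V, MeasurableSet B →
        m B ≤ (r ^ 3 : ℝ≥0) * m₂ B ∧ m₂ B ≤ (r ^ 3 : ℝ≥0) * m B := by
      intro w hw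
      obtain ⟨V, hV, hVB⟩ := hc w hw r hr
      refine ⟨_, inter_mem hV (hloc w hw r hr), fun B hB hBm => ?_⟩
      obtain ⟨h1, h2⟩ := hVB B (hB.trans inter_subset_left) hBm
      have h3 : (c w : ℝ≥0∞) * ν B ≤ (r ^ 2 : ℝ≥0) * m₂ B := by
        rw [withDensity_apply _ hBm, ← lintegral_const_mul' _ _ ENNReal.coe_ne_top,
          ← setLIntegral_const]
        exact setLIntegral_mono' hBm fun x hx => by exact_mod_cast (hB hx).2.2
      have h4 : m₂ B ≤ (r ^ 2 : ℝ≥0) * (c w * ν B) := by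
        rw [withDensity_apply _ hBm, ← mul_assoc, ← ENNReal.coe_mul, ← setLIntegral_const]
        exact setLIntegral_mono' hBm fun x hx => by exact_mod_cast (hB hx).2.1
      constructor
      · calc m B ≤ r * (c w * ν B) := h1
          _ ≤ r * ((r ^ 2 : ℝ≥0) * m₂ B) := by gcongr
          _ = _ := by push_cast; ring
      · calc m₂ B ≤ (r ^ 2 : ℝ≥0) * (c w * ν B) := h4
          _ ≤ (r ^ 2 : ℝ≥0) * (r * m B) := by gcongr
          _ = _ := by push_cast; ring
    intro B hBT hB
    constructor
    · exact measure_le_of_locally_le m (((r ^ 3 : ℝ≥0) : ℝ≥0∞) • m₂)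
        (fun w hw => (hbd w hw).imp fun V hV => ⟨hV.1, fun B hB hBm => by
          exact (hV.2 B hB hBm).1⟩) B hBT hB
    · exact measure_le_of_locally_le m₂ (((r ^ 3 : ℝ≥0) : ℝ≥0∞) • m)
        (fun w hw => (hbd w hw).imp fun V hV => ⟨hV.1, fun B hB hBm => by
          exact (hV.2 B hB hBm).2⟩) B hBT hB
  have hroot : ∀ s : ℝ≥0, 1 < s → ∃ r : ℝ≥0, 1 < r ∧ r ^ 3 ≤ s := by
    intro s hs
    have h1 : Tendsto (fun r : ℝ≥0 => r ^ 3) (𝓝[>] 1) (𝓝 (1 ^ 3)) :=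
      (continuous_id.pow 3).continuousAt.mono_left nhdsWithin_le_nhds
    rw [one_pow] at h1
    obtain ⟨r, hr1, hr2⟩ := ((h1.eventually_le_const hs).and self_mem_nhdsWithin).exists
    exact ⟨r, hr2, hr1⟩
  rw [← restrict_withDensity hT.measurableSet]
  ext B hB
  rw [Measure.restrict_apply hB, Measure.restrict_apply hB]
  refine le_antisymm (ENNReal.le_of_forall_one_lt_le_mul fun s hs => ?_)
    (ENNReal.le_of_forall_one_lt_le_mul fun s hs => ?_)
  · obtain ⟨r, hr, hrs⟩ := hroot s hs
    exact (key r hr _ inter_subset_right (hB.inter hT.measurableSet)).1.trans (by gcongr)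
  · obtain ⟨r, hr, hrs⟩ := hroot s hs
    exact (key r hr _ inter_subset_right (hB.inter hT.measurableSet)).2.trans (by gcongr)

/-! ### Hausdorff measure under differentiable maps -/

/-- If distances between values of `g` are bounded by those between values of `f`, then so are
the Hausdorff measures of the images. -/
theorem hausdorffMeasure_image_le_of_edist_le {X Y Z : Type*} [Nonempty X] [EMetricSpace Y]
    [MeasurableSpace Y] [BorelSpace Y] [EMetricSpace Z] [MeasurableSpace Z] [BorelSpace Z]
    {f : X → Y} {g : X → Z} {A : Set X} {C : ℝ≥0}
    (h : ∀ x ∈ A, ∀ y ∈ A, edist (g x) (g y) ≤ C * edist (f x) (f y)) {d : ℝ} (hd : 0 ≤ d) :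
    μH[d] (g '' A) ≤ (C : ℝ≥0∞) ^ d * μH[d] (f '' A) := by
  have hinv : ∀ x ∈ A, Function.invFunOn f A (f x) ∈ A ∧ f (Function.invFunOn f A (f x)) = f x :=
    fun x hx => Function.invFunOn_pos ⟨x, hx, rfl⟩
  -- `f` need not be injective: the distance bound forces `g` to be constant on its fibres in `A`,
  -- so `g` factors through a Lipschitz map on `f '' A`.
  have hg : ∀ x ∈ A, g (Function.invFunOn f A (f x)) = g x := fun x hx => by
    have := h _ (hinv x hx).1 x hx
    rw [(hinv x hx).2, edist_self, mul_zero, nonpos_iff_eq_zero, edist_eq_zero] at this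
    exact this
  have hlip : LipschitzOnWith C (g ∘ Function.invFunOn f A) (f '' A) := by
    rintro _ ⟨x, hx, rfl⟩ _ ⟨y, hy, rfl⟩
    simpa [hg x hx, hg y hy] using h x hx y hy
  have himg : (g ∘ Function.invFunOn f A) '' (f '' A) = g '' A := by
    rw [image_image]
    exact image_congr fun x hx => hg x hx
  simpa only [himg] using hlip.hausdorffMeasure_image_le hd

/-- Near a point of strict differentiability with injective derivative, a map distorts the
Hausdorff measure of small sets like its derivative does. -/
theorem HasStrictFDerivAt.hausdorffMeasure_comparable {E F : Type*} [NormedAddCommGroup E]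
    [NormedSpace ℝ E] [FiniteDimensional ℝ E] [NormedAddCommGroup F] [NormedSpace ℝ F]
    [MeasurableSpace F] [BorelSpace F] {f : E → F} {L : E →L[ℝ] F} {x : E}
    (hf : HasStrictFDerivAt f L x) (hL : Function.Injective L) {d : ℝ} (hd : 0 ≤ d)
    {r : ℝ≥0} (hr : 1 < r) :
    ∃ V ∈ 𝓝 x, ∀ A ⊆ V, μH[d] (f '' A) ≤ r * μH[d] (L '' A) ∧
      μH[d] (L '' A) ≤ r * μH[d] (f '' A) := by
  obtain ⟨K, hK0, hK⟩ := L.toLinearMap.exists_antilipschitzWith (LinearMap.ker_eq_bot.2 hL)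
  have h1 : Tendsto (fun t : ℝ≥0 => ((1 + t) ^ d : ℝ≥0)) (𝓝[>] 0) (𝓝 ((1 + 0) ^ d)) := by
    exact ((NNReal.continuous_rpow_const hd).comp
      (continuous_const.add continuous_id)).continuousAt.mono_left nhdsWithin_le_nhds
  rw [add_zero, NNReal.one_rpow] at h1
  obtain ⟨η, hη1, hη2⟩ := ((h1.eventually_le_const hr).and self_mem_nhdsWithin).exists
  have hη0 : (0 : ℝ) < η := hη2
  have hK0' : (0 : ℝ) < K := hK0
  -- With this `δ` the linearization error is at most η/(1+η) times ‖L(p - q)‖. Since 1 - η/(1+η) =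
  -- 1/(1+η), the distances under `f` and `L` agree up to the factor 1 + η in both directions.
  set δ : ℝ≥0 := η / ((1 + η) * K) with hδ
  have hδ0 : 0 < δ := by positivity
  have hδr : (δ : ℝ) = η / ((1 + η) * K) := by simp [hδ]
  obtain ⟨V, hV, hVa⟩ := hf.approximates_deriv_on_nhds (Or.inr hδ0)
  have hanti : ∀ v, ‖v‖ ≤ K * ‖L v‖ := fun v => by
    simpa using hK.le_mul_dist v 0
  refine ⟨V, hV, fun A hA => ?_⟩
  have hest : ∀ p ∈ A, ∀ q ∈ A, ‖f p - f q - L (p - q)‖ ≤ η / (1 + η) * ‖L (p - q)‖ := by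
    intro p hp q hq
    calc _ ≤ δ * ‖p - q‖ := hVa p (hA hp) q (hA hq)
      _ ≤ δ * (K * ‖L (p - q)‖) := by gcongr; exact hanti _
      _ = _ := by rw [hδr]; field_simp
  have hηη : (η : ℝ) / (1 + η) ≤ η := div_le_self hη0.le (by linarith)
  have hη' : (1 : ℝ) - η / (1 + η) = 1 / (1 + η) := by field_simp; ring
  have conv : ∀ {a b : ℝ}, 0 ≤ b → a ≤ (1 + η) * b →
      ENNReal.ofReal a ≤ ((1 + η : ℝ≥0) : ℝ≥0∞) * ENNReal.ofReal b := by
    intro a b hb hab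
    rw [← ENNReal.ofReal_coe_nnreal, ← ENNReal.ofReal_mul (by positivity)]
    exact ENNReal.ofReal_le_ofReal (by simpa using hab)
  have hpow : ((1 + η : ℝ≥0) : ℝ≥0∞) ^ d ≤ r := by
    rw [← ENNReal.coe_rpow_of_nonneg _ hd]; exact_mod_cast hη1
  constructor
  · refine (hausdorffMeasure_image_le_of_edist_le (C := 1 + η) ?_ hd).trans (by gcongr)
    intro p hp q hq
    rw [edist_dist, edist_dist]
    refine conv dist_nonneg ?_
    rw [dist_eq_norm, dist_eq_norm, ← map_sub]
    have h2 := hest p hp q hq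
    have h3 : ‖f p - f q‖ ≤ ‖f p - f q - L (p - q)‖ + ‖L (p - q)‖ := by
      simpa using norm_add_le (f p - f q - L (p - q)) (L (p - q))
    nlinarith [norm_nonneg (L (p - q))]
  · refine (hausdorffMeasure_image_le_of_edist_le (C := 1 + η) ?_ hd).trans (by gcongr)
    intro p hp q hq
    rw [edist_dist, edist_dist]
    refine conv dist_nonneg ?_
    rw [dist_eq_norm, dist_eq_norm, ← map_sub]
    have h2 := hest p hp q hq
    have h3 : ‖L (p - q)‖ ≤ ‖f p - f q‖ + ‖f p - f q - L (p - q)‖ := by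
      simpa using norm_sub_le (f p - f q) (f p - f q - L (p - q))
    have h4 : (1 / (1 + η) : ℝ) * ‖L (p - q)‖ ≤ ‖f p - f q‖ := by
      rw [← hη']; linarith
    rw [one_div, inv_mul_le_iff₀ (by positivity)] at h4
    exact h4

/-! ### Charts with continuous density -/

/-- The Euclidean plane. -/
abbrev E2 : Type := EuclideanSpace ℝ (Fin 2)

/-- In the chart `e`, the measure `μ` has a continuous density with respect to `ν`. -/
def HasContinuousDensity {X E : Type*} [TopologicalSpace X] [MeasurableSpace X]
    [TopologicalSpace E] [MeasurableSpace E] (e : OpenPartialHomeomorph X E)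
    (μ : Measure X) (ν : Measure E) : Prop :=
  ∃ k : E → ℝ≥0, ContinuousOn k e.target ∧
    Measure.map e (μ.restrict e.source) = (ν.restrict e.target).withDensity fun w => (k w : ℝ≥0∞)

section Density

variable {X E : Type*} [TopologicalSpace X] [MeasurableSpace X] [BorelSpace X]
  [TopologicalSpace E] [MeasurableSpace E] [BorelSpace E]

theorem OpenPartialHomeomorph.aemeasurable_restrict [TopologicalSpace.PseudoMetrizableSpace E]
    (e : OpenPartialHomeomorph X E) (μ : Measure X) : AEMeasurable e (μ.restrict e.source) :=
  e.continuousOn.aemeasurable e.open_source.measurableSet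

/-- The comparison is asked for arbitrary `B`, as Hausdorff estimates of images supply it without
measurability; only Borel sets are needed to identify the density. -/
theorem hasContinuousDensity_of_comparable [TopologicalSpace.PseudoMetrizableSpace E] [SecondCountableTopology E]
    (e : OpenPartialHomeomorph X E) (μ : Measure X) (ν : Measure E) [ν.IsOpenPosMeasure]
    [IsLocallyFiniteMeasure ν]
    (h : ∀ p ∈ e.target, ∃ c : ℝ≥0, ∀ r : ℝ≥0, 1 < r → ∃ V ∈ 𝓝 p, ∀ B ⊆ V, B ⊆ e.target →
      μ (e.symm '' B) ≤ r * (c * ν B) ∧ c * ν B ≤ r * μ (e.symm '' B)) :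
    HasContinuousDensity e μ ν := by
  have hmap : ∀ B, MeasurableSet B →
      Measure.map e (μ.restrict e.source) B = μ (e ⁻¹' B ∩ e.source) := fun B hB => by
    rw [Measure.map_apply_of_aemeasurable (e.aemeasurable_restrict μ) hB,
      Measure.restrict_apply' e.open_source.measurableSet]
  obtain ⟨k, hk, hkm⟩ := exists_continuousOn_density (Measure.map e (μ.restrict e.source)) ν
    e.open_target fun p hp => by
      obtain ⟨c, hc⟩ := h p hp
      refine ⟨c, fun r hr => ?_⟩
      obtain ⟨V, hV, hVB⟩ := hc r hr
      refine ⟨V ∩ e.target, inter_mem hV (e.open_target.mem_nhds hp), fun B hB hBm => ?_⟩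
      have hBt : B ⊆ e.target := hB.trans inter_subset_right
      rw [hmap B hBm, inter_comm, ← e.symm_image_eq_source_inter_preimage hBt]
      exact hVB B (hB.trans inter_subset_left) hBt
  refine ⟨k, hk, ?_⟩
  rw [← hkm]
  ext B hB
  rw [Measure.restrict_apply hB, hmap B hB, hmap _ (hB.inter e.open_target.measurableSet)]
  congr 1
  ext x
  simp only [mem_inter_iff, mem_preimage]
  exact ⟨fun hx => ⟨⟨hx.1, e.map_source hx.2⟩, hx.2⟩, fun hx => ⟨hx.1.1, hx.2⟩⟩

/-- Transport of a compactly supported function through a chart with continuous density. -/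
theorem HasContinuousDensity.exists_transport [T2Space X] [T2Space E] [TopologicalSpace.PseudoMetrizableSpace E]
    [SecondCountableTopology E]
    {e : OpenPartialHomeomorph X E} {μ : Measure X} {ν : Measure E}
    (he : HasContinuousDensity e μ ν) {H : X → ℂ} (hH : Continuous H) (hHc : HasCompactSupport H)
    (hHs : tsupport H ⊆ e.source) :
    ∃ G : E → ℂ, Continuous G ∧ HasCompactSupport G ∧ tsupport G ⊆ e '' tsupport H ∧
      ∀ ψ : E → ℂ, ContinuousOn ψ e.target → ∫ x, H x * ψ (e x) ∂μ = ∫ w, G w * ψ w ∂ν := by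
  obtain ⟨k, hk, hkm⟩ := he
  have hGc : ContinuousOn (fun w => H (e.symm w)) e.target := hH.comp_continuousOn e.continuousOn_symm
  set G : E → ℂ := e.target.indicator fun w => (k w : ℝ) • H (e.symm w) with hGdef
  have hKc : IsCompact (e '' tsupport H) := hHc.isCompact.image_of_continuousOn
    (e.continuousOn.mono hHs)
  have hsupp : Function.support G ⊆ e '' tsupport H := by
    intro w hw
    have hwt : w ∈ e.target := by
      by_contra hcon
      exact hw (indicator_of_notMem hcon _)
    refine ⟨e.symm w, subset_tsupport _ fun h0 => hw ?_, e.right_inv hwt⟩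
    simp [hGdef, h0]
  have htsupp : tsupport G ⊆ e '' tsupport H := closure_minimal hsupp hKc.isClosed
  refine ⟨G, ?_, hKc.of_isClosed_subset (isClosed_tsupport G) htsupp, htsupp, fun ψ hψ => ?_⟩
  · refine continuous_of_tsupport fun w hw => ?_
    have hwt : w ∈ e.target := by
      obtain ⟨x, hx, rfl⟩ := htsupp hw
      exact e.map_source (hHs hx)
    have hev : G =ᶠ[𝓝 w] fun w => (k w : ℝ) • H (e.symm w) := by
      filter_upwards [e.open_target.mem_nhds hwt] with v hv
      exact indicator_of_mem hv _
    refine ContinuousAt.congr ?_ hev.symm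
    exact ((NNReal.continuous_coe.continuousAt.comp (hk.continuousAt (e.open_target.mem_nhds hwt))).smul
      (hGc.continuousAt (e.open_target.mem_nhds hwt)))
  · have h1 : ∫ x, H x * ψ (e x) ∂μ = ∫ x in e.source, H x * ψ (e x) ∂μ := by
      refine (setIntegral_eq_integral_of_forall_compl_eq_zero fun x hx => ?_).symm
      rw [image_eq_zero_of_notMem_tsupport fun h => hx (hHs h), zero_mul]
    have h2 : ∫ x in e.source, H x * ψ (e x) ∂μ =
        ∫ x in e.source, (fun w => H (e.symm w) * ψ w) (e x) ∂μ :=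
      setIntegral_congr_fun e.open_source.measurableSet fun x hx => by simp [e.left_inv hx]
    have hasm : AEStronglyMeasurable (fun w => H (e.symm w) * ψ w) (ν.restrict e.target) :=
      (hGc.mul hψ).aestronglyMeasurable e.open_target.measurableSet
    have hasm' : AEStronglyMeasurable (fun w => H (e.symm w) * ψ w)
        (Measure.map e (μ.restrict e.source)) := by
      rw [hkm]
      exact hasm.mono_ac (withDensity_absolutelyContinuous _ _)
    rw [h1, h2, ← integral_map (e.aemeasurable_restrict μ) hasm', hkm,
      integral_withDensity_eq_integral_smul₀ (hk.aemeasurable e.open_target.measurableSet),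
      ← integral_indicator e.open_target.measurableSet]
    congr 1
    ext w
    by_cases hw : w ∈ e.target
    · simp only [hGdef, indicator_of_mem hw]
      rw [NNReal.smul_def, smul_mul_assoc]
    · simp only [hGdef, indicator_of_notMem hw, zero_mul]

theorem HasContinuousDensity.prod {Y F : Type*} [TopologicalSpace Y] [MeasurableSpace Y]
    [BorelSpace Y] [TopologicalSpace F] [MeasurableSpace F] [BorelSpace F]
    [TopologicalSpace.PseudoMetrizableSpace E] [TopologicalSpace.PseudoMetrizableSpace F]
    [SecondCountableTopology E] [SecondCountableTopology F]
    {e : OpenPartialHomeomorph X E} {μ : Measure X} {ν : Measure E} [SFinite μ] [SFinite ν]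
    {e' : OpenPartialHomeomorph Y F} {μ' : Measure Y} {ν' : Measure F} [SFinite μ'] [SFinite ν']
    (he : HasContinuousDensity e μ ν) (he' : HasContinuousDensity e' μ' ν') :
    HasContinuousDensity (e.prod e') (μ.prod μ') (ν.prod ν') := by
  obtain ⟨k, hk, hkm⟩ := he
  obtain ⟨k', hk', hkm'⟩ := he'
  refine ⟨fun w => k w.1 * k' w.2, ?_, ?_⟩
  · exact (hk.comp continuousOn_fst fun w hw => hw.1).mul
      (hk'.comp continuousOn_snd fun w hw => hw.2)
  · have hs : (e.prod e').source = e.source ×ˢ e'.source := rfl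
    have ht : (e.prod e').target = e.target ×ˢ e'.target := rfl
    have hc : (e.prod e' : X × Y → E × F) = Prod.map e e' := rfl
    rw [hs, ht, hc, ← Measure.prod_restrict, ← Measure.prod_restrict]
    have h1 : Measure.map (Prod.map e e') ((μ.restrict e.source).prod (μ'.restrict e'.source)) =
        (Measure.map e (μ.restrict e.source)).prod (Measure.map e' (μ'.restrict e'.source)) := by
      have hm := e.aemeasurable_restrict μ
      have hm' := e'.aemeasurable_restrict μ'
      -- The charts are controlled only on their sources, so the product rule for push-forwards is
      -- applied to measurable representatives.
      rw [Measure.map_congr hm.ae_eq_mk, Measure.map_congr hm'.ae_eq_mk,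
        Measure.map_prod_map _ _ hm.measurable_mk hm'.measurable_mk]
      refine Measure.map_congr ?_
      filter_upwards [Measure.quasiMeasurePreserving_fst.ae hm.ae_eq_mk,
        Measure.quasiMeasurePreserving_snd.ae hm'.ae_eq_mk] with x hx hx'
      exact Prod.ext hx hx'
    rw [h1, hkm, hkm', prod_withDensity₀]
    · simp
    · exact (hk.aemeasurable e.open_target.measurableSet).coe_nnreal_ennreal
    · exact (hk'.aemeasurable e'.open_target.measurableSet).coe_nnreal_ennreal

end Density

/-! ### Local parametrization of a Hölder surface -/

theorem exists_orthonormalBasis_last_eq {u : E3} (hu : ‖u‖ = 1) :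
    ∃ B : OrthonormalBasis (Fin 3) ℝ E3, B 2 = u := by
  have hv : Orthonormal ℝ (({2} : Set (Fin 3)).domRestrict fun _ => u) := by
    refine ⟨fun i => hu, fun i j hij => ?_⟩
    exact absurd (Subsingleton.elim i j) hij
  obtain ⟨B, hB⟩ := hv.exists_orthonormalBasis_extension_of_card_eq (by simp)
  exact ⟨B, hB 2 rfl⟩

/-- The coordinates of a vector with respect to the first two vectors of an orthonormal basis. -/
noncomputable def planeCoords (B : OrthonormalBasis (Fin 3) ℝ E3) : E3 →L[ℝ] E2 :=
  (EuclideanSpace.equiv (Fin 2) ℝ).symm.toContinuousLinearMap ∘L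
    ContinuousLinearMap.pi fun i : Fin 2 => innerSL ℝ (B i.castSucc)

theorem planeCoords_apply (B : OrthonormalBasis (Fin 3) ℝ E3) (v : E3) (i : Fin 2) :
    planeCoords B v i = ⟪B i.castSucc, v⟫ := by
  simp [planeCoords]

theorem norm_sq_eq_planeCoords (B : OrthonormalBasis (Fin 3) ℝ E3) (v : E3) :
    ‖v‖ ^ 2 = ‖planeCoords B v‖ ^ 2 + ⟪B 2, v⟫ ^ 2 := by
  rw [← B.sum_sq_inner_right v, Fin.sum_univ_three, EuclideanSpace.norm_sq_eq, Fin.sum_univ_two]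
  simp only [planeCoords_apply, Real.norm_eq_abs, sq_abs]
  rfl

theorem norm_planeCoords_le (B : OrthonormalBasis (Fin 3) ℝ E3) (v : E3) :
    ‖planeCoords B v‖ ≤ ‖v‖ := by
  have := norm_sq_eq_planeCoords B v
  exact abs_le_of_sq_le_sq' (by nlinarith [sq_nonneg ⟪B 2, v⟫]) (norm_nonneg _) |>.2

theorem surfaceMeasure_apply (S : Set E3) (A : Set S) :
    surfaceMeasure S A = μHE[2] (Subtype.val '' A) :=
  (isometry_subtype_coe.euclideanHausdorffMeasure_image A).symm

/-- Near each of its points, a Hölder surface has a `C¹` parametrization in whose coordinates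
the surface measure has a continuous density. -/
theorem IsHolderSurface.exists_chart {β b : ℝ} {S Sstar : Set E3} {n : E3 → E3}
    (hS : IsHolderSurface β b S Sstar n) (x₀ : S) :
    ∃ (e : OpenPartialHomeomorph S E2) (f : E2 → E3), x₀ ∈ e.source ∧
      HasContinuousDensity e (surfaceMeasure S) volume ∧
      (∀ p ∈ e.target, ContDiffAt ℝ 1 f p ∧ f p = e.symm p) ∧
      Function.Injective (fderiv ℝ f (e x₀)) ∧
      ∀ v, ⟪n x₀, fderiv ℝ f (e x₀) v⟫ = 0 := by
  obtain ⟨U, Φ, hU, -, -, ⟨hΦ, -⟩, hSU, hgrad, hn⟩ := hS.levelSet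
  obtain ⟨O, hO, hSO⟩ := hS.relOpen
  have hx₀s : (x₀ : E3) ∈ Sstar := hS.subset x₀.2
  have hx₀U : (x₀ : E3) ∈ U ∧ Φ x₀ = 0 := by rw [hSU] at hx₀s; exact hx₀s
  have hg0 := hgrad _ hx₀s
  set w := gradient Φ x₀ with hw
  obtain ⟨B, hB⟩ := exists_orthonormalBasis_last_eq (u := ‖w‖⁻¹ • w)
    (by rw [norm_smul, norm_inv, norm_norm, inv_mul_cancel₀ (norm_ne_zero_iff.2 hg0)])
  set ℓ := planeCoords B with hℓ
  have hΦd : HasFDerivAt Φ (innerSL ℝ w) x₀ := by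
    have h1 : DifferentiableAt ℝ Φ x₀ :=
      (hΦ.contDiffAt (hU.mem_nhds hx₀U.1)).differentiableAt one_ne_zero
    exact h1.hasGradientAt.hasFDerivAt
  set T : E3 →L[ℝ] ℝ × E2 := (innerSL ℝ w).prod ℓ with hT
  have hTinj : Function.Injective T := by
    refine (injective_iff_map_eq_zero T).2 fun v hv => ?_
    have h1 : ⟪w, v⟫ = 0 := congrArg Prod.fst hv
    have h2 : ℓ v = 0 := congrArg Prod.snd hv
    have h3 := norm_sq_eq_planeCoords B v
    rw [← hℓ, h2, hB, inner_smul_left, h1] at h3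
    simpa using h3
  set T' : E3 ≃L[ℝ] ℝ × E2 :=
    (LinearEquiv.ofInjectiveOfFinrankEq T.toLinearMap hTinj (by simp)).toContinuousLinearEquiv
    with hT'
  -- Pairing `Φ` with the tangential coordinates straightens the surface to {0} × ℝ². The surface is
  -- then a graph over its tangent plane at `x₀`, with the projection `ℓ` as chart.
  set g : E3 → ℝ × E2 := fun x => (Φ x, ℓ x) with hg
  have hgc : ContDiffAt ℝ 1 g x₀ :=
    (hΦ.contDiffAt (hU.mem_nhds hx₀U.1)).prodMk ℓ.contDiff.contDiffAt
  have hgd : HasFDerivAt g (T' : E3 →L[ℝ] ℝ × E2) x₀ := hΦd.prodMk ℓ.hasFDerivAt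
  set G := hgc.toOpenPartialHomeomorph g hgd one_ne_zero with hG
  have hGg : ∀ x, G x = g x := fun x => rfl
  have hx₀G : (x₀ : E3) ∈ G.source := hgc.mem_toOpenPartialHomeomorph_source hgd one_ne_zero
  have hgx₀ : g x₀ = (0, ℓ x₀) := by simp [hg, hx₀U.2]
  set f : E2 → E3 := fun p => G.symm (0, p) with hf
  have hfx₀ : f (ℓ x₀) = x₀ := by
    rw [hf]; simp only; rw [← hgx₀, ← hGg, G.left_inv hx₀G]
  have hGsymm : ContDiffAt ℝ 1 G.symm (0, ℓ x₀) := by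
    rw [← hgx₀]; exact hgc.to_localInverse hgd one_ne_zero
  have hι : Continuous fun p : E2 => ((0 : ℝ), p) := by fun_prop
  have htend : Tendsto (fun p : E2 => ((0 : ℝ), p)) (𝓝 (ℓ x₀)) (𝓝 (0, ℓ x₀)) := hι.tendsto _
  have hev : ∀ᶠ p in 𝓝 (ℓ x₀), ((0 : ℝ), p) ∈ G.target ∧ f p ∈ U ∩ O ∧
      ContDiffAt ℝ 1 G.symm (0, p) := by
    refine (htend.eventually (G.open_target.mem_nhds ?_)).and (Filter.Eventually.and ?_
      (htend.eventually (hGsymm.eventually (by simp))))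
    · rw [← hgx₀, ← hGg]; exact G.map_source hx₀G
    · have hcf : ContinuousAt f (ℓ x₀) := hGsymm.continuousAt.comp hι.continuousAt
      refine hcf.eventually_mem ((hU.inter hO).mem_nhds ?_)
      rw [hfx₀]
      exact ⟨hx₀U.1, (hSO.subset x₀.2).2⟩
  obtain ⟨W, hWev, hWo, hx₀W⟩ := mem_nhds_iff.1 hev
  have hfS : ∀ p ∈ W, f p ∈ S := fun p hp => by
    have h1 := hWev hp
    have h2 : g (f p) = (0, p) := G.right_inv h1.1
    rw [hSO, hSU]
    exact ⟨⟨h1.2.1.1, congrArg Prod.fst h2⟩, h1.2.1.2⟩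
  have hℓf : ∀ p ∈ W, ℓ (f p) = p := fun p hp => by
    have h2 : g (f p) = (0, p) := G.right_inv (hWev hp).1
    exact congrArg Prod.snd h2
  have hfc : ∀ p ∈ W, ContDiffAt ℝ 1 f p := fun p hp =>
    (hWev hp).2.2.comp p (contDiffAt_const.prodMk contDiffAt_id)
  classical
  let e : OpenPartialHomeomorph S E2 :=
    { toFun := fun x => ℓ x
      invFun := fun p => if h : f p ∈ S then ⟨f p, h⟩ else x₀
      source := {x | (x : E3) ∈ G.source ∧ ℓ x ∈ W}
      target := W
      map_source' := fun x hx => hx.2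
      map_target' := fun p hp => by
        simp only [hfS p hp, dite_true, mem_ofPred_eq, hℓf p hp]
        exact ⟨G.map_target (hWev hp).1, hp⟩
      left_inv' := fun x hx => by
        have h1 : Φ x = 0 := by
          have := hS.subset x.2
          rw [hSU] at this
          exact this.2
        have h2 : f (ℓ x) = x := by
          have : g x = (0, ℓ x) := by simp [hg, h1]
          rw [hf]; simp only; rw [← this, ← hGg, G.left_inv hx.1]
        simp [h2]
      right_inv' := fun p hp => by simp only [hfS p hp, dite_true, hℓf p hp]
      open_source := (G.open_source.preimage continuous_subtype_val).inter
        (hWo.preimage (ℓ.continuous.comp continuous_subtype_val))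
      open_target := hWo
      continuousOn_toFun := (ℓ.continuous.comp continuous_subtype_val).continuousOn
      continuousOn_invFun := by
        rw [Topology.IsInducing.subtypeVal.continuousOn_iff]
        refine ContinuousOn.congr (f := f) (fun p hp => (hfc p hp).continuousAt.continuousWithinAt) ?_
        intro p hp
        simp [hfS p hp] }
  have hesymm : ∀ p ∈ W, f p = e.symm p := fun p hp => by
    change f p = ((if h : f p ∈ S then (⟨f p, h⟩ : S) else x₀ : S) : E3)
    simp [hfS p hp]
  have hfinj : ∀ p ∈ W, Function.Injective (fderiv ℝ f p) := by
    intro p hp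
    have h1 : HasFDerivAt (fun q => ℓ (f q)) (ℓ ∘L fderiv ℝ f p) p :=
      ℓ.hasFDerivAt.comp p ((hfc p hp).differentiableAt one_ne_zero).hasFDerivAt
    have h2 : HasFDerivAt (fun q => ℓ (f q)) (ContinuousLinearMap.id ℝ E2) p :=
      (hasFDerivAt_id p).congr_of_eventuallyEq
        (by filter_upwards [hWo.mem_nhds hp] with q hq using hℓf q hq)
    have h3 := h1.unique h2
    intro v v' hvv
    simpa using (DFunLike.congr_fun h3 v).symm.trans
      ((congrArg ℓ hvv).trans (DFunLike.congr_fun h3 v'))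
  refine ⟨e, f, ⟨hx₀G, hx₀W⟩, ?_, fun p hp => ⟨hfc p hp, hesymm p hp⟩, hfinj _ hx₀W, ?_⟩
  · refine hasContinuousDensity_of_comparable e _ _ fun p hp => ?_
    -- The density at `p` is the two-dimensional Jacobian of the parametrization.
    refine ⟨(fderiv ℝ f p).toLinearMap.normDet.toNNReal, fun r hr => ?_⟩
    obtain ⟨V, hV, hVA⟩ := ((hfc p hp).hasStrictFDerivAt one_ne_zero).hausdorffMeasure_comparable
      (hfinj p hp) (d := (2 : ℕ)) (by positivity) hr
    refine ⟨V, hV, fun A hA hAW => ?_⟩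
    have h1 : surfaceMeasure S (e.symm '' A) = μHE[2] (f '' A) := by
      rw [surfaceMeasure_apply, image_image]
      congr 1
      exact image_congr fun q hq => (hesymm q (hAW hq)).symm
    have h2 : ((fderiv ℝ f p).toLinearMap.normDet.toNNReal : ℝ≥0∞) * volume A =
        μHE[2] (fderiv ℝ f p '' A) := by
      have := (fderiv ℝ f p).toLinearMap.euclideanHausdorffMeasure_image_eq_normDet_mul_volume A
      rw [finrank_euclideanSpace_fin] at this
      exact this.symm
    rw [h1, h2]
    simp only [Measure.euclideanHausdorffMeasure_def, Measure.smul_apply, ENNReal.smul_def,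
      smul_eq_mul]
    obtain ⟨h3, h4⟩ := hVA A hA
    constructor
    · rw [mul_left_comm]; gcongr
    · rw [mul_left_comm]; gcongr
  · intro v
    change ⟪n x₀, fderiv ℝ f (ℓ x₀) v⟫ = 0
    have h1 : HasFDerivAt (fun q => Φ (f q)) ((innerSL ℝ w) ∘L fderiv ℝ f (ℓ x₀)) (ℓ x₀) := by
      have h0 : HasFDerivAt Φ (innerSL ℝ w) (f (ℓ x₀)) := by rw [hfx₀]; exact hΦd
      exact h0.comp _ ((hfc _ hx₀W).differentiableAt one_ne_zero).hasFDerivAt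
    have h2 : HasFDerivAt (fun q => Φ (f q)) (0 : E2 →L[ℝ] ℝ) (ℓ x₀) := by
      refine (hasFDerivAt_const (0 : ℝ) _).congr_of_eventuallyEq ?_
      filter_upwards [hWo.mem_nhds hx₀W] with q hq
      have h2 : g (f q) = (0, q) := G.right_inv (hWev hq).1
      exact congrArg Prod.fst h2
    have h3 : ⟪w, fderiv ℝ f (ℓ x₀) v⟫ = 0 := DFunLike.congr_fun (h1.unique h2) v
    obtain ⟨-, c, hc⟩ := hn _ hx₀s
    rw [hc, inner_smul_left, h3, mul_zero]

/-! ### Local diffeomorphisms and the sum of two surfaces -/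

theorem exists_measure_image_eq_mul {E F : Type*} [NormedAddCommGroup E] [NormedSpace ℝ E]
    [FiniteDimensional ℝ E] [MeasurableSpace E] [BorelSpace E] [NormedAddCommGroup F]
    [NormedSpace ℝ F] [FiniteDimensional ℝ F] [MeasurableSpace F] [BorelSpace F]
    (μ : Measure F) [μ.IsAddHaarMeasure] (ν : Measure E) [ν.IsAddHaarMeasure]
    (L : E ≃L[ℝ] F) : ∃ c : ℝ≥0, ∀ A, μ (L '' A) = c * ν A := by
  refine ⟨(μ.map L.symm).addHaarScalarFactor ν, fun A => ?_⟩
  have h1 : μ.map L.symm = (μ.map L.symm).addHaarScalarFactor ν • ν :=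
    Measure.isAddLeftInvariant_eq_smul _ _
  have h2 : μ.map L.symm A = μ (L '' A) := by
    have := L.symm.toHomeomorph.toMeasurableEquiv.map_apply (μ := μ) A
    rw [L.image_eq_preimage_symm]
    exact this
  rw [← h2]
  conv_lhs => rw [h1]
  rfl

/-- A local diffeomorphism transforms a Haar measure into a measure with continuous density. -/
theorem hasContinuousDensity_of_contDiffAt {E F : Type*} [NormedAddCommGroup E] [NormedSpace ℝ E]
    [FiniteDimensional ℝ E] [MeasurableSpace E] [BorelSpace E] [NormedAddCommGroup F]
    [NormedSpace ℝ F] [FiniteDimensional ℝ F] [MeasurableSpace F] [BorelSpace F]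
    (hEF : Module.finrank ℝ E = Module.finrank ℝ F)
    (e : OpenPartialHomeomorph F E) (μ : Measure F) [μ.IsAddHaarMeasure] (ν : Measure E)
    [ν.IsAddHaarMeasure]
    (he : ∀ p ∈ e.target, ContDiffAt ℝ 1 e.symm p ∧ Function.Injective (fderiv ℝ e.symm p)) :
    HasContinuousDensity e μ ν := by
  refine hasContinuousDensity_of_comparable e μ ν fun p hp => ?_
  obtain ⟨hd, hinj⟩ := he p hp
  set L : E ≃L[ℝ] F :=
    (LinearEquiv.ofInjectiveOfFinrankEq (fderiv ℝ e.symm p).toLinearMap hinj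
      hEF).toContinuousLinearEquiv with hL
  have hLc : ∀ v, L v = fderiv ℝ e.symm p v := fun v => rfl
  obtain ⟨c, hc⟩ := exists_measure_image_eq_mul μ ν L
  refine ⟨c, fun r hr => ?_⟩
  obtain ⟨V, hV, hVA⟩ := (hd.hasStrictFDerivAt one_ne_zero).hausdorffMeasure_comparable
      hinj (d := Module.finrank ℝ F) (by positivity) hr
  refine ⟨V, hV, fun A hA _ => ?_⟩
  -- Haar measure is a multiple of the full-dimensional Hausdorff measure, so the Hausdorff
  -- comparison applies and no Jacobian formula is needed.
  have h1 : μ = μ.addHaarScalarFactor μH[Module.finrank ℝ F] • μH[Module.finrank ℝ F] :=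
    Measure.isAddLeftInvariant_eq_smul _ _
  rw [← hc, image_congr fun v _ => hLc v]
  rw [h1]
  simp only [Measure.smul_apply, ENNReal.smul_def, smul_eq_mul]
  obtain ⟨h3, h4⟩ := hVA A hA
  constructor
  · rw [mul_left_comm]; gcongr
  · rw [mul_left_comm]; gcongr

/-- The ranges of `D₁` and `D₂` are the planes orthogonal to `a` and `b`. These are distinct, so
they span ℝ³, and the kernel of the sum map has dimension 4 - 3 = 1. Any functional that does not
vanish on this line completes the map. -/
theorem exists_functional_injective {D₁ D₂ : E2 →L[ℝ] E3} {a b : E3}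
    (hD₁ : Function.Injective D₁) (hD₂ : Function.Injective D₂)
    (ha : ∀ v, ⟪a, D₁ v⟫ = 0) (hb : ∀ v, ⟪b, D₂ v⟫ = 0) (hab : LinearIndependent ℝ ![a, b]) :
    ∃ l : E2 × E2 →L[ℝ] ℝ, Function.Injective (l.prod (D₁.coprod D₂)) := by
  have horth : ∀ (D : E2 →L[ℝ] E3) (a : E3), a ≠ 0 → Function.Injective D →
      (∀ v, ⟪a, D v⟫ = 0) → D.range = (ℝ ∙ a)ᗮ := by
    intro D a ha0 hD ha
    refine Submodule.eq_of_le_of_finrank_eq ?_ ?_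
    · rintro _ ⟨v, rfl⟩
      rw [Submodule.mem_orthogonal_singleton_iff_inner_right]
      exact ha v
    · have : Fact (Module.finrank ℝ E3 = 2 + 1) := ⟨by simp⟩
      rw [Submodule.finrank_orthogonal_span_singleton (n := 2) ha0]
      have := LinearMap.finrank_range_of_inj (f := D.toLinearMap) hD
      simpa using this
  have ha0 : a ≠ 0 := hab.ne_zero 0
  have hb0 : b ≠ 0 := hab.ne_zero 1
  have hsup : D₁.range ⊔ D₂.range = ⊤ := by
    rw [horth D₁ a ha0 hD₁ ha, horth D₂ b hb0 hD₂ hb, ← Submodule.orthogonal_eq_bot_iff,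
      ← Submodule.inf_orthogonal, Submodule.orthogonal_orthogonal, Submodule.orthogonal_orthogonal,
      Submodule.eq_bot_iff]
    rintro x ⟨hx1, hx2⟩
    obtain ⟨s, rfl⟩ := Submodule.mem_span_singleton.1 hx1
    obtain ⟨t, ht⟩ := Submodule.mem_span_singleton.1 hx2
    have := (LinearIndependent.pair_iff.1 hab) s (-t) (by rw [neg_smul, ht, add_neg_cancel])
    rw [this.1, zero_smul]
  have hsurj : (D₁.coprod D₂).toLinearMap.range = ⊤ := by
    rw [← hsup]
    exact LinearMap.range_coprod D₁.toLinearMap D₂.toLinearMap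
  have hker : Module.finrank ℝ (D₁.coprod D₂).toLinearMap.ker = 1 := by
    have := (D₁.coprod D₂).toLinearMap.finrank_range_add_finrank_ker
    rw [hsurj, finrank_top] at this
    simp at this
    omega
  obtain ⟨v, hv0, hv⟩ := finrank_eq_one_iff'.1 hker
  obtain ⟨l, hl⟩ := SeparatingDual.exists_ne_zero (R := ℝ) (x := (v : E2 × E2)) (by simpa using hv0)
  refine ⟨l, (injective_iff_map_eq_zero _).2 fun w hw => ?_⟩
  have h1 : l w = 0 := congrArg Prod.fst hw
  have h2 : (D₁.coprod D₂) w = 0 := congrArg Prod.snd hw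
  obtain ⟨c, hc⟩ := hv ⟨w, h2⟩
  have hc' : c • (v : E2 × E2) = w := congrArg Subtype.val hc
  rw [← hc', map_smul, smul_eq_mul] at h1
  rcases mul_eq_zero.1 h1 with h | h
  · rw [← hc', h, zero_smul]
  · exact absurd h hl

/-- Two transversal parametrized surfaces: the sum, completed by a linear functional, is a local
diffeomorphism, with the Lebesgue measure transforming into one with continuous density. -/
theorem exists_sum_chart {f₁ f₂ : E2 → E3} {p₀ q₀ : E2} {O₁ O₂ : Set E2} (hO₁ : IsOpen O₁)
    (hO₂ : IsOpen O₂) (hp₀ : p₀ ∈ O₁) (hq₀ : q₀ ∈ O₂) (hf₁ : ∀ p ∈ O₁, ContDiffAt ℝ 1 f₁ p)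
    (hf₂ : ∀ p ∈ O₂, ContDiffAt ℝ 1 f₂ p) {a b : E3}
    (hD₁ : Function.Injective (fderiv ℝ f₁ p₀)) (hD₂ : Function.Injective (fderiv ℝ f₂ q₀))
    (ha : ∀ v, ⟪a, fderiv ℝ f₁ p₀ v⟫ = 0) (hb : ∀ v, ⟪b, fderiv ℝ f₂ q₀ v⟫ = 0)
    (hab : LinearIndependent ℝ ![a, b]) :
    ∃ e : OpenPartialHomeomorph (E2 × E2) (ℝ × E3), (p₀, q₀) ∈ e.source ∧
      e.source ⊆ O₁ ×ˢ O₂ ∧ HasContinuousDensity e volume volume ∧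
      ∀ w, (e w).2 = f₁ w.1 + f₂ w.2 := by
  obtain ⟨l, hl⟩ := exists_functional_injective hD₁ hD₂ ha hb hab
  set g : E2 × E2 → ℝ × E3 := fun w => (l w, f₁ w.1 + f₂ w.2) with hg
  have hgc : ∀ w ∈ O₁ ×ˢ O₂, ContDiffAt ℝ 1 g w := fun w hw =>
    l.contDiff.contDiffAt.prodMk (((hf₁ _ hw.1).comp w contDiffAt_fst).add
      ((hf₂ _ hw.2).comp w contDiffAt_snd))
  set T : (E2 × E2) ≃L[ℝ] ℝ × E3 := (LinearEquiv.ofInjectiveOfFinrankEq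
    (l.prod ((fderiv ℝ f₁ p₀).coprod (fderiv ℝ f₂ q₀))).toLinearMap hl
      (by simp)).toContinuousLinearEquiv with hT
  have hgd : HasFDerivAt g (T : E2 × E2 →L[ℝ] ℝ × E3) (p₀, q₀) := by
    have h1 := ((hf₁ _ hp₀).differentiableAt one_ne_zero).hasFDerivAt
    have h2 := ((hf₂ _ hq₀).differentiableAt one_ne_zero).hasFDerivAt
    have h3 : HasFDerivAt (fun w : E2 × E2 => f₁ w.1 + f₂ w.2)
        ((fderiv ℝ f₁ p₀).coprod (fderiv ℝ f₂ q₀)) (p₀, q₀) := by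
      refine ((h1.comp (p₀, q₀) hasFDerivAt_fst).add (h2.comp (p₀, q₀) hasFDerivAt_snd)).congr_fderiv ?_
      ext v <;> simp
    exact l.hasFDerivAt.prodMk h3
  have hgc₀ := hgc (p₀, q₀) ⟨hp₀, hq₀⟩
  set G := hgc₀.toOpenPartialHomeomorph g hgd one_ne_zero with hG
  have hGg : ∀ x, G x = g x := fun x => rfl
  have hG₀ : (p₀, q₀) ∈ G.source := hgc₀.mem_toOpenPartialHomeomorph_source hgd one_ne_zero
  have hGt₀ : g (p₀, q₀) ∈ G.target := G.map_source hG₀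
  have hGsymm₀ : G.symm (g (p₀, q₀)) = (p₀, q₀) := G.left_inv hG₀
  have hGsymm : ContDiffAt ℝ 1 G.symm (g (p₀, q₀)) := hgc₀.to_localInverse hgd one_ne_zero
  have hev : ∀ᶠ w in 𝓝 (g (p₀, q₀)), G.symm w ∈ O₁ ×ˢ O₂ ∧ ContDiffAt ℝ 1 G.symm w := by
    refine Filter.Eventually.and (hGsymm.continuousAt.eventually_mem ?_)
      (hGsymm.eventually (by simp))
    rw [hGsymm₀]
    exact (hO₁.prod hO₂).mem_nhds ⟨hp₀, hq₀⟩
  obtain ⟨W, hWev, hWo, hW₀⟩ := mem_nhds_iff.1 hev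
  -- The restriction is made on the target side, so that the inverse is C¹ at every point of the
  -- target, not only at the base point.
  refine ⟨(G.symm.restrOpen W hWo).symm, ?_, ?_, ?_, fun w => rfl⟩
  · change (p₀, q₀) ∈ (G.symm.restrOpen W hWo).target
    have := (G.symm.restrOpen W hWo).map_source (x := g (p₀, q₀)) ⟨hGt₀, hW₀⟩
    rwa [OpenPartialHomeomorph.coe_restrOpen, hGsymm₀] at this
  · intro w hw
    have h1 := (G.symm.restrOpen W hWo).map_target hw
    have h2 : G.symm ((G.symm.restrOpen W hWo).symm w) = w :=
      (G.symm.restrOpen W hWo).right_inv hw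
    rw [← h2]
    exact (hWev h1.2).1
  · have i₁ : (volume : Measure (E2 × E2)).IsAddHaarMeasure :=
      inferInstanceAs ((volume : Measure E2).prod (volume : Measure E2)).IsAddHaarMeasure
    have i₂ : (volume : Measure (ℝ × E3)).IsAddHaarMeasure :=
      inferInstanceAs ((volume : Measure ℝ).prod (volume : Measure E3)).IsAddHaarMeasure
    refine hasContinuousDensity_of_contDiffAt (by simp) _ _ _ fun w hw => ?_
    have hw' : w ∈ G.target ∩ W := hw
    change ContDiffAt ℝ 1 G.symm w ∧ Function.Injective (fderiv ℝ G.symm w)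
    refine ⟨(hWev hw'.2).2, ?_⟩
    have h1 : HasFDerivAt (fun v => g (G.symm v)) (fderiv ℝ g (G.symm w) ∘L fderiv ℝ G.symm w) w :=
      ((hgc _ (hWev hw'.2).1).differentiableAt one_ne_zero).hasFDerivAt.comp w
        ((hWev hw'.2).2.differentiableAt one_ne_zero).hasFDerivAt
    have h2 : HasFDerivAt (fun v => g (G.symm v)) (ContinuousLinearMap.id ℝ (ℝ × E3)) w :=
      (hasFDerivAt_id w).congr_of_eventuallyEq (by
        filter_upwards [G.open_target.mem_nhds hw'.1] with v hv using G.right_inv hv)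
    have h3 := h1.unique h2
    intro v v' hvv
    simpa using (DFunLike.congr_fun h3 v).symm.trans
      ((congrArg (fderiv ℝ g (G.symm w)) hvv).trans (DFunLike.congr_fun h3 v'))

/-! ### Continuity of the convolution -/

/-- The image under addition of the measure `H · (μ₁ × μ₂)` has a continuous compactly supported
density. -/
def HasSumDensity {S₁ S₂ : Set E3} (μ₁ : Measure S₁) (μ₂ : Measure S₂) (H : S₁ × S₂ → ℂ) : Prop :=
  ∃ F : E3 → ℂ, Continuous F ∧ HasCompactSupport F ∧ ∀ ψ : E3 → ℂ, Continuous ψ →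
    ∫ w, H w * ψ ((w.1 : E3) + (w.2 : E3)) ∂(μ₁.prod μ₂) = ∫ z, F z * ψ z

/-- The auxiliary real coordinate of the sum chart is integrated out; compact support keeps the
fibre integral continuous. -/
theorem exists_fiber_integral {K : ℝ × E3 → ℂ} (hK : Continuous K) (hKc : HasCompactSupport K) :
    ∃ F : E3 → ℂ, Continuous F ∧ HasCompactSupport F ∧ ∀ ψ : E3 → ℂ, Continuous ψ →
      ∫ w, K w * ψ w.2 = ∫ z, F z * ψ z := by
  refine ⟨fun z => ∫ s, K (s, z), ?_, ?_, fun ψ hψ => ?_⟩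
  · rw [← continuousOn_univ]
    refine continuousOn_integral_of_compact_support (hKc.isCompact.image continuous_fst)
      (f := fun z s => K (s, z)) ?_ ?_
    · exact (hK.comp continuous_swap).continuousOn
    · intro z s _ hs
      by_contra h0
      exact hs ⟨(s, z), subset_tsupport _ h0, rfl⟩
  · refine HasCompactSupport.of_support_subset_isCompact (hKc.isCompact.image continuous_snd) ?_
    intro z hz
    by_contra hcon
    refine hz ?_
    have : ∀ s, K (s, z) = 0 := fun s => by
      by_contra h0
      exact hcon ⟨(s, z), subset_tsupport _ h0, rfl⟩
    simp [this]
  · have hi : Integrable (fun w : ℝ × E3 => K w * ψ w.2)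
        ((volume : Measure ℝ).prod (volume : Measure E3)) :=
      (hK.mul (hψ.comp continuous_snd)).integrable_of_hasCompactSupport hKc.mul_right
    rw [Measure.volume_eq_prod, integral_prod_symm _ hi]
    congr 1
    ext z
    exact integral_mul_const (ψ z) fun s => K (s, z)

/-- `H` is transported twice, first by the product of the two surface charts to ℝ² × ℝ², then by the
sum chart to ℝ × ℝ³, where addition is the second projection. -/
theorem exists_nhds_hasSumDensity {β b : ℝ} {S₁ S₂ T₁ T₂ : Set E3} {n₁ n₂ : E3 → E3}
    (h₁ : IsHolderSurface β b S₁ T₁ n₁) (h₂ : IsHolderSurface β b S₂ T₂ n₂)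
    [SFinite (surfaceMeasure S₁)] [SFinite (surfaceMeasure S₂)] (x₀ : S₁ × S₂)
    (hab : LinearIndependent ℝ ![n₁ x₀.1, n₂ x₀.2]) :
    ∃ W, IsOpen W ∧ x₀ ∈ W ∧ ∀ H : S₁ × S₂ → ℂ, Continuous H → HasCompactSupport H →
      tsupport H ⊆ W → HasSumDensity (surfaceMeasure S₁) (surfaceMeasure S₂) H := by
  obtain ⟨e₁, f₁, hx₁, hd₁, hf₁, hi₁, ho₁⟩ := h₁.exists_chart x₀.1
  obtain ⟨e₂, f₂, hx₂, hd₂, hf₂, hi₂, ho₂⟩ := h₂.exists_chart x₀.2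
  obtain ⟨G, hG₀, hGs, hGd, hG⟩ := exists_sum_chart e₁.open_target e₂.open_target
    (e₁.map_source hx₁) (e₂.map_source hx₂) (fun p hp => (hf₁ p hp).1) (fun p hp => (hf₂ p hp).1)
    hi₁ hi₂ ho₁ ho₂ hab
  have hd := hd₁.prod hd₂
  refine ⟨(e₁.prod e₂).source ∩ (e₁.prod e₂) ⁻¹' G.source,
    (e₁.prod e₂).isOpen_inter_preimage G.open_source, ⟨⟨hx₁, hx₂⟩, hG₀⟩, fun H hH hHc hHs => ?_⟩
  obtain ⟨H₁, hH₁, hH₁c, hH₁s, hH₁i⟩ :=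
    hd.exists_transport hH hHc (hHs.trans inter_subset_left)
  have hH₁G : tsupport H₁ ⊆ G.source := by
    refine hH₁s.trans ?_
    rintro _ ⟨x, hx, rfl⟩
    exact (hHs hx).2
  obtain ⟨H₂, hH₂, hH₂c, -, hH₂i⟩ := hGd.exists_transport hH₁ hH₁c hH₁G
  obtain ⟨F, hF, hFc, hFi⟩ := exists_fiber_integral hH₂ hH₂c
  refine ⟨F, hF, hFc, fun ψ hψ => ?_⟩
  rw [← hFi ψ hψ, ← hH₂i (fun w => ψ w.2) (hψ.comp continuous_snd).continuousOn,
    Measure.volume_eq_prod]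
  simp only [hG]
  rw [← hH₁i (fun w => ψ (f₁ w.1 + f₂ w.2))]
  · congr 1
    ext w
    by_cases hw : w ∈ tsupport H
    · have hw' := (hHs hw).1
      have h3 : f₁ (e₁ w.1) = w.1 := by
        rw [(hf₁ _ (e₁.map_source hw'.1)).2, e₁.left_inv hw'.1]
      have h4 : f₂ (e₂ w.2) = w.2 := by
        rw [(hf₂ _ (e₂.map_source hw'.2)).2, e₂.left_inv hw'.2]
      change _ = H w * ψ (f₁ (e₁ w.1) + f₂ (e₂ w.2))
      rw [h3, h4]
    · simp [image_eq_zero_of_notMem_tsupport hw]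
  · intro w hw
    refine ContinuousAt.continuousWithinAt (hψ.continuousAt.comp (ContinuousAt.add ?_ ?_))
    · exact (hf₁ _ hw.1).1.continuousAt.comp continuousAt_fst
    · exact (hf₂ _ hw.2).1.continuousAt.comp continuousAt_snd

theorem HasSumDensity.sum {S₁ S₂ : Set E3} {μ₁ : Measure S₁} {μ₂ : Measure S₂} [IsFiniteMeasure μ₁]
    [IsFiniteMeasure μ₂] {ι : Type*} [Fintype ι] {H : ι → S₁ × S₂ → ℂ}
    (hc : ∀ i, Continuous (H i)) (hs : ∀ i, HasCompactSupport (H i))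
    (h : ∀ i, HasSumDensity μ₁ μ₂ (H i)) : HasSumDensity μ₁ μ₂ fun w => ∑ i, H i w := by
  choose F hF hFc hFi using h
  refine ⟨fun z => ∑ i, F i z, continuous_finsetSum _ fun i _ => hF i, ?_, fun ψ hψ => ?_⟩
  · refine HasCompactSupport.of_support_subset_isCompact
      (isCompact_iUnion fun i => (hFc i).isCompact) fun z hz => ?_
    by_contra hcon
    refine hz (Finset.sum_eq_zero fun i _ => ?_)
    by_contra h0
    exact hcon (mem_iUnion.2 ⟨i, subset_tsupport _ h0⟩)
  · simp only [Finset.sum_mul]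
    rw [integral_finsetSum, integral_finsetSum]
    · exact Finset.sum_congr rfl fun i _ => hFi i ψ hψ
    · exact fun i _ => ((hF i).mul hψ).integrable_of_hasCompactSupport (hFc i).mul_right
    · exact fun i _ => ((hc i).mul (hψ.comp (by fun_prop))).integrable_of_hasCompactSupport
        (hs i).mul_right

/-- A partition of unity on the compact support of `H` splits it into finitely many pieces to which
the local statement applies. -/
theorem hasSumDensity_of_locally {S₁ S₂ : Set E3} {μ₁ : Measure S₁} {μ₂ : Measure S₂}
    [IsFiniteMeasure μ₁] [IsFiniteMeasure μ₂] [LocallyCompactSpace S₁] [LocallyCompactSpace S₂]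
    (h : ∀ x : S₁ × S₂, ∃ W, IsOpen W ∧ x ∈ W ∧ ∀ H : S₁ × S₂ → ℂ, Continuous H →
      HasCompactSupport H → tsupport H ⊆ W → HasSumDensity μ₁ μ₂ H)
    {H : S₁ × S₂ → ℂ} (hH : Continuous H) (hHc : HasCompactSupport H) :
    HasSumDensity μ₁ μ₂ H := by
  choose W hWo hxW hW using h
  obtain ⟨t, ht⟩ := hHc.isCompact.elim_finite_subcover W hWo
    fun x _ => mem_iUnion.2 ⟨x, hxW x⟩
  have hcov : tsupport H ⊆ ⋃ i : Fin t.card, W (t.equivFin.symm i) := by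
    intro x hx
    obtain ⟨y, hy, hxy⟩ := mem_iUnion₂.1 (ht hx)
    refine mem_iUnion.2 ⟨t.equivFin ⟨y, hy⟩, ?_⟩
    simpa using hxy
  obtain ⟨f, hfs, hf1, -, -⟩ := exists_continuous_sum_one_of_isOpen_isCompact
    (fun i => hWo (t.equivFin.symm i)) hHc.isCompact hcov
  have hcont : ∀ i, Continuous fun w => (f i w : ℂ) * H w := fun i =>
    (Complex.continuous_ofReal.comp (f i).continuous).mul hH
  have hsum : H = fun w => ∑ i, (f i w : ℂ) * H w := by
    ext w
    by_cases hw : w ∈ tsupport H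
    · have := hf1 hw
      simp only [Finset.sum_apply, Pi.one_apply] at this
      rw [← Finset.sum_mul, ← Complex.ofReal_sum, this, Complex.ofReal_one, one_mul]
    · simp [image_eq_zero_of_notMem_tsupport hw]
  rw [hsum]
  refine HasSumDensity.sum hcont (fun i => hHc.mul_left) fun i =>
    hW (t.equivFin.symm i) _ (hcont i) hHc.mul_left ?_
  refine Subset.trans (closure_mono fun w hw => ?_) (hfs i)
  intro h0
  exact hw (by simp [h0])

/-! ### Area of pieces of a Hölder surface -/

section Holder

variable {β b : ℝ} {S Sstar : Set E3} {n : E3 → E3}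

theorem IsHolderSurface.norm_normal (hS : IsHolderSurface β b S Sstar n) {x : E3}
    (hx : x ∈ Sstar) : ‖n x‖ = 1 := by
  obtain ⟨U, Φ, -, -, -, -, -, -, hn⟩ := hS.levelSet
  exact (hn x hx).1

theorem IsHolderSurface.norm_normal_sub_le (hS : IsHolderSurface β b S Sstar n) (hb : 0 < b)
    {x y : E3} (hx : x ∈ Sstar) (hy : y ∈ Sstar) : ‖n x - n y‖ ≤ b * ‖x - y‖ ^ β := by
  rcases eq_or_ne x y with rfl | hxy
  · simp only [sub_self, norm_zero]; positivity
  have h0 : 0 < ‖x - y‖ := norm_sub_pos_iff.2 hxy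
  rw [← div_le_iff₀ (by positivity)]
  exact (le_add_of_nonneg_right (by positivity)).trans (hS.holder x hx y hy hxy)

theorem IsHolderSurface.abs_inner_normal_le (hS : IsHolderSurface β b S Sstar n) (hb : 0 < b)
    {x y : E3} (hx : x ∈ Sstar) (hy : y ∈ Sstar) :
    |⟪n x, x - y⟫| ≤ b * ‖x - y‖ ^ (1 + β) := by
  rcases eq_or_ne x y with rfl | hxy
  · simp only [sub_self, inner_zero_right, abs_zero]; positivity
  have h0 : 0 < ‖x - y‖ := norm_sub_pos_iff.2 hxy
  rw [← div_le_iff₀ (by positivity)]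
  exact (le_add_of_nonneg_left (by positivity)).trans (hS.holder x hx y hy hxy)

/-- A small piece of a Hölder surface has area at most four times the area of its projection to
a tangent plane. -/
theorem IsHolderSurface.area_le (hS : IsHolderSurface β b S Sstar n) (hb : 0 < b) (hβ : 0 < β)
    {A : Set E3} (hA : A ⊆ Sstar) {z : E3} (hz : z ∈ A) {d : ℝ}
    (hd : ∀ x ∈ A, ∀ y ∈ A, ‖x - y‖ ≤ d) (hbd : 4 * b * d ^ β ≤ 1)
    {B : OrthonormalBasis (Fin 3) ℝ E3} (hB : B 2 = n z) :
    μHE[2] A ≤ 4 * volume (planeCoords B '' A) := by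
  have hest : ∀ x ∈ A, ∀ y ∈ A, ‖x - y‖ ≤ 2 * ‖planeCoords B (x - y)‖ := by
    intro x hx y hy
    set v := x - y with hv
    have hpow : ∀ {s : ℝ}, 0 ≤ s → s ≤ d → s ^ β ≤ d ^ β := fun h0 h1 =>
      Real.rpow_le_rpow h0 h1 hβ.le
    have h1 : |⟪n x, v⟫| ≤ b * d ^ β * ‖v‖ := by
      refine (hS.abs_inner_normal_le hb (hA hx) (hA hy)).trans ?_
      rw [← hv, Real.rpow_add' (norm_nonneg _) (by positivity), Real.rpow_one, mul_comm ‖v‖,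
        ← mul_assoc]
      gcongr
      exact hd x hx y hy
    have h2 : |⟪n z - n x, v⟫| ≤ b * d ^ β * ‖v‖ := by
      refine (abs_real_inner_le_norm _ _).trans ?_
      gcongr
      refine (hS.norm_normal_sub_le hb (hA hz) (hA hx)).trans ?_
      gcongr
      exact hd z hz x hx
    -- Both Hölder terms are at most ‖v‖/4. By Pythagoras the inverse of the projection is then
    -- 2-Lipschitz, whence the area factor 4.
    have h3 : |⟪n z, v⟫| ≤ 1 / 2 * ‖v‖ := by
      have h4 : ⟪n z, v⟫ = ⟪n x, v⟫ + ⟪n z - n x, v⟫ := by rw [inner_sub_left]; ring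
      rw [h4]
      refine (abs_add_le _ _).trans ?_
      nlinarith [norm_nonneg v]
    have h4 := norm_sq_eq_planeCoords B v
    rw [hB, ← sq_abs ⟪n z, v⟫] at h4
    have h5 : |⟪n z, v⟫| ^ 2 ≤ (1 / 2 * ‖v‖) ^ 2 := by gcongr
    refine abs_le_of_sq_le_sq' ?_ (by positivity) |>.2
    nlinarith
  have h6 : μH[(2 : ℕ)] (id '' A) ≤ ((2 : ℝ≥0) : ℝ≥0∞) ^ ((2 : ℕ) : ℝ) *
      μH[(2 : ℕ)] (planeCoords B '' A) := by
    refine hausdorffMeasure_image_le_of_edist_le (fun x hx y hy => ?_) (by positivity)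
    rw [edist_dist, edist_dist, ← ENNReal.ofReal_coe_nnreal, ← ENNReal.ofReal_mul (by positivity)]
    refine ENNReal.ofReal_le_ofReal ?_
    rw [dist_eq_norm, dist_eq_norm, ← map_sub]
    exact hest x hx y hy
  rw [image_id, ENNReal.rpow_natCast] at h6
  have h7 : ((2 : ℝ≥0) : ℝ≥0∞) ^ 2 = 4 := by norm_num
  rw [h7] at h6
  rw [← EuclideanSpace.euclideanHausdorffMeasure_eq_volume]
  simp only [Measure.euclideanHausdorffMeasure_def, Measure.smul_apply, ENNReal.smul_def,
      smul_eq_mul]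
  rw [mul_left_comm]
  gcongr

theorem IsHolderSurface.surfaceMeasure_ball_le (hS : IsHolderSurface β b S Sstar n) (hb : 0 < b)
    (hβ : 0 < β) {ε : ℝ} (hε : 0 < ε) (hbε : 4 * b * (2 * ε) ^ β ≤ 1) (w : E3) :
    surfaceMeasure S {y : S | ‖w - y‖ < ε} ≤ ENNReal.ofReal (16 * Real.pi * ε ^ 2) := by
  rw [surfaceMeasure_apply]
  set A := Subtype.val '' {y : S | ‖w - y‖ < ε} with hA
  have hA' : ∀ x ∈ A, x ∈ S ∧ ‖w - x‖ < ε := by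
    rintro _ ⟨y, hy, rfl⟩
    exact ⟨y.2, hy⟩
  rcases A.eq_empty_or_nonempty with h0 | ⟨z, hz⟩
  · simp [h0]
  obtain ⟨B, hB⟩ := exists_orthonormalBasis_last_eq (hS.norm_normal (hS.subset (hA' z hz).1))
  have hd : ∀ x ∈ A, ∀ y ∈ A, ‖x - y‖ ≤ 2 * ε := by
    intro x hx y hy
    have h1 : x - y = (w - y) - (w - x) := by abel
    rw [h1]
    linarith [norm_sub_le (w - y) (w - x), (hA' x hx).2, (hA' y hy).2]
  refine (hS.area_le hb hβ (fun x hx => hS.subset (hA' x hx).1) hz hd hbε hB).trans ?_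
  have h2 : planeCoords B '' A ⊆ Metric.closedBall (planeCoords B z) (2 * ε) := by
    rintro _ ⟨x, hx, rfl⟩
    rw [Metric.mem_closedBall, dist_eq_norm, ← map_sub]
    exact (norm_planeCoords_le B _).trans (hd x hx z hz)
  calc 4 * volume (planeCoords B '' A)
      ≤ 4 * volume (Metric.closedBall (planeCoords B z) (2 * ε)) := by gcongr
    _ = ENNReal.ofReal (16 * Real.pi * ε ^ 2) := by
      rw [EuclideanSpace.volume_closedBall_fin_two, ← ENNReal.ofReal_pow (by positivity),
        ← ENNReal.ofReal_mul (by positivity),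
        show (4 : ℝ≥0∞) = ENNReal.ofReal 4 by simp, ← ENNReal.ofReal_mul (by positivity)]
      congr 1
      ring

theorem exists_pos_mul_rpow_le (a K : ℝ) {β : ℝ} (hβ : 0 < β) :
    ∃ ε₀ : ℝ, 0 < ε₀ ∧ ∀ ε, 0 < ε → ε ≤ ε₀ → K * (a * ε) ^ β ≤ 1 := by
  have h1 : Tendsto (fun ε : ℝ => K * (a * ε) ^ β) (𝓝 0) (𝓝 (K * (a * 0) ^ β)) :=
    (continuous_const.mul ((continuous_const.mul continuous_id).rpow_const
      fun _ => Or.inr hβ.le)).tendsto 0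
  rw [mul_zero, Real.zero_rpow hβ.ne', mul_zero] at h1
  obtain ⟨δ, hδ, h⟩ := Metric.eventually_nhds_iff.1 (h1.eventually_le_const zero_lt_one)
  refine ⟨δ / 2, by positivity, fun ε h0 h2 => h ?_⟩
  rw [Real.dist_eq, sub_zero, abs_of_pos h0]
  linarith

theorem IsHolderSurface.isFiniteMeasure (hS : IsHolderSurface β b S Sstar n) (hb : 0 < b)
    (hβ : 0 < β) : IsFiniteMeasure (surfaceMeasure S) := by
  obtain ⟨ε, hε, h⟩ := exists_pos_mul_rpow_le 2 (4 * b) hβ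
  obtain ⟨t, ht, hcov⟩ := Metric.totallyBounded_iff.1 (hS.bounded.isCompact_closure.totallyBounded.subset
    subset_closure) ε hε
  refine ⟨?_⟩
  have h1 : (univ : Set S) ⊆ ⋃ w ∈ t, {y : S | ‖w - (y : E3)‖ < ε} := fun y _ => by
    obtain ⟨w, hw, hyw⟩ := mem_iUnion₂.1 (hcov y.2)
    refine mem_iUnion₂.2 ⟨w, hw, ?_⟩
    have h2 : ‖(y : E3) - w‖ < ε := by rw [← dist_eq_norm]; exact hyw
    rwa [norm_sub_rev] at h2
  refine (measure_mono h1).trans_lt (measure_biUnion_lt_top ht fun w _ => ?_)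
  exact (hS.surfaceMeasure_ball_le hb hβ hε (h ε hε le_rfl) w).trans_lt ENNReal.ofReal_lt_top

/-- The level set is relatively closed in the open set `U`, so it is locally closed, and so is its
intersection with the open set `O`. -/
theorem IsHolderSurface.locallyCompactSpace (hS : IsHolderSurface β b S Sstar n) :
    LocallyCompactSpace S := by
  obtain ⟨U, Φ, hU, -, -, ⟨hΦ, -⟩, hSU, -, -⟩ := hS.levelSet
  obtain ⟨O, hO, hSO⟩ := hS.relOpen
  have h1 : IsLocallyClosed Sstar := by
    obtain ⟨C, hC, hCU⟩ := (continuousOn_iff_isClosed.1 hΦ.continuousOn) {0} isClosed_singleton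
    have : Sstar = C ∩ U := by
      rw [← hCU, hSU]
      ext x
      exact ⟨fun h => ⟨h.2, h.1⟩, fun h => ⟨h.2, h.1⟩⟩
    rw [this]
    exact hC.isLocallyClosed.inter hU.isLocallyClosed
  rw [hSO]
  exact (h1.inter hO.isLocallyClosed).locallyCompactSpace

end Holder

/-! ### Linear algebra of transversality -/

/-- The determinant of three vectors. -/
theorem det_of_columns (u : Fin 3 → E3) :
    (Matrix.of fun k i : Fin 3 => u i k).det =
      u 0 0 * (u 1 1 * u 2 2 - u 2 1 * u 1 2) - u 1 0 * (u 0 1 * u 2 2 - u 2 1 * u 0 2) +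
        u 2 0 * (u 0 1 * u 1 2 - u 1 1 * u 0 2) := by
  rw [Matrix.det_fin_three]
  simp only [Matrix.of_apply]
  ring

/-- Cauchy–Schwarz for (a × b) · w, combined with Lagrange's identity |a × b|² = |a|²|b|² - (a ·
b)². -/
theorem sq_triple_product_le (a₀ a₁ a₂ b₀ b₁ b₂ w₀ w₁ w₂ : ℝ) :
    ((a₁ * b₂ - a₂ * b₁) * w₀ + (a₂ * b₀ - a₀ * b₂) * w₁ + (a₀ * b₁ - a₁ * b₀) * w₂) ^ 2 ≤
      (a₀ ^ 2 + a₁ ^ 2 + a₂ ^ 2) * (b₀ ^ 2 + b₁ ^ 2 + b₂ ^ 2) * (w₀ ^ 2 + w₁ ^ 2 + w₂ ^ 2) := by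
  have hcs : ∀ c₀ c₁ c₂ : ℝ, (c₀ * w₀ + c₁ * w₁ + c₂ * w₂) ^ 2 ≤
      (c₀ ^ 2 + c₁ ^ 2 + c₂ ^ 2) * (w₀ ^ 2 + w₁ ^ 2 + w₂ ^ 2) := fun c₀ c₁ c₂ => by
    nlinarith [sq_nonneg (c₀ * w₁ - c₁ * w₀), sq_nonneg (c₀ * w₂ - c₂ * w₀),
      sq_nonneg (c₁ * w₂ - c₂ * w₁)]
  refine (hcs _ _ _).trans (mul_le_mul_of_nonneg_right ?_ (by positivity))
  linear_combination sq_nonneg (a₀ * b₀ + a₁ * b₁ + a₂ * b₂)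

theorem EuclideanSpace.inner_fin_three (v w : E3) :
    ⟪v, w⟫ = v 0 * w 0 + v 1 * w 1 + v 2 * w 2 := by
  rw [PiLp.inner_apply, Fin.sum_univ_three]
  simp [mul_comm]

theorem abs_triple_product_le {a b : E3} (ha : ‖a‖ = 1) (hb : ‖b‖ = 1) (w : E3) :
    |(a 1 * b 2 - a 2 * b 1) * w 0 + (a 2 * b 0 - a 0 * b 2) * w 1 +
      (a 0 * b 1 - a 1 * b 0) * w 2| ≤ ‖w‖ := by
  have ha' := EuclideanSpace.real_norm_sq_eq a
  have hb' := EuclideanSpace.real_norm_sq_eq b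
  have hw' := EuclideanSpace.real_norm_sq_eq w
  rw [Fin.sum_univ_three] at ha' hb' hw'
  refine abs_le_of_sq_le_sq ?_ (norm_nonneg w)
  refine (sq_triple_product_le _ _ _ _ _ _ _ _ _).trans ?_
  rw [← ha', ← hb', ← hw', ha, hb]
  simp

/-- By Cramer's rule det(u) v is the sum of ⟨uᵢ, v⟩ times the cross product of the other two
vectors. Pair this with `v`; the cross products have norm at most 1. -/
theorem norm_mul_det_le {u : Fin 3 → E3} (hu : ∀ i, ‖u i‖ = 1) {θ : ℝ}
    (hdet : θ ≤ (Matrix.of fun k i : Fin 3 => u i k).det) (v : E3) :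
    θ * ‖v‖ ≤ |⟪u 0, v⟫| + |⟪u 1, v⟫| + |⟪u 2, v⟫| := by
  rcases eq_or_ne v 0 with rfl | hv
  · simp
  have k0 := abs_triple_product_le (hu 1) (hu 2) v
  have k1 := abs_triple_product_le (hu 2) (hu 0) v
  have k2 := abs_triple_product_le (hu 0) (hu 1) v
  have hid : (Matrix.of fun k i : Fin 3 => u i k).det * ‖v‖ ^ 2 =
      ⟪u 0, v⟫ * ((u 1 1 * u 2 2 - u 1 2 * u 2 1) * v 0 + (u 1 2 * u 2 0 - u 1 0 * u 2 2) * v 1 +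
        (u 1 0 * u 2 1 - u 1 1 * u 2 0) * v 2) +
      ⟪u 1, v⟫ * ((u 2 1 * u 0 2 - u 2 2 * u 0 1) * v 0 + (u 2 2 * u 0 0 - u 2 0 * u 0 2) * v 1 +
        (u 2 0 * u 0 1 - u 2 1 * u 0 0) * v 2) +
      ⟪u 2, v⟫ * ((u 0 1 * u 1 2 - u 0 2 * u 1 1) * v 0 + (u 0 2 * u 1 0 - u 0 0 * u 1 2) * v 1 +
        (u 0 0 * u 1 1 - u 0 1 * u 1 0) * v 2) := by
    rw [det_of_columns, EuclideanSpace.inner_fin_three, EuclideanSpace.inner_fin_three,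
      EuclideanSpace.inner_fin_three, EuclideanSpace.real_norm_sq_eq, Fin.sum_univ_three]
    ring
  generalize (u 1 1 * u 2 2 - u 1 2 * u 2 1) * v 0 + (u 1 2 * u 2 0 - u 1 0 * u 2 2) * v 1 +
        (u 1 0 * u 2 1 - u 1 1 * u 2 0) * v 2 = d0 at *
  generalize (u 2 1 * u 0 2 - u 2 2 * u 0 1) * v 0 + (u 2 2 * u 0 0 - u 2 0 * u 0 2) * v 1 +
        (u 2 0 * u 0 1 - u 2 1 * u 0 0) * v 2 = d1 at *
  generalize (u 0 1 * u 1 2 - u 0 2 * u 1 1) * v 0 + (u 0 2 * u 1 0 - u 0 0 * u 1 2) * v 1 +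
        (u 0 0 * u 1 1 - u 0 1 * u 1 0) * v 2 = d2 at *
  have h1 : θ * ‖v‖ ^ 2 ≤ (|⟪u 0, v⟫| + |⟪u 1, v⟫| + |⟪u 2, v⟫|) * ‖v‖ := by
    calc θ * ‖v‖ ^ 2 ≤ _ := mul_le_mul_of_nonneg_right hdet (sq_nonneg ‖v‖)
      _ = _ := hid
      _ ≤ |⟪u 0, v⟫ * d0| + |⟪u 1, v⟫ * d1| + |⟪u 2, v⟫ * d2| :=
        add_le_add (add_le_add (le_abs_self _) (le_abs_self _)) (le_abs_self _)
      _ ≤ |⟪u 0, v⟫| * ‖v‖ + |⟪u 1, v⟫| * ‖v‖ + |⟪u 2, v⟫| * ‖v‖ := by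
        rw [abs_mul, abs_mul, abs_mul]; gcongr
      _ = _ := by ring
  refine le_of_mul_le_mul_right ?_ (norm_pos_iff.2 hv)
  linarith [h1, sq ‖v‖]

/-- Written in the basis `B`, the third column is (0, 0, 1), so the determinant reduces to the minor
of the tangential coordinates of `u 0` and `u 1`. -/
theorem abs_det_eq_planeCoords (u : Fin 3 → E3) (B : OrthonormalBasis (Fin 3) ℝ E3)
    (hB : B 2 = u 2) :
    |(Matrix.of fun k i : Fin 3 => u i k).det| =
      |planeCoords B (u 0) 0 * planeCoords B (u 1) 1 -
        planeCoords B (u 0) 1 * planeCoords B (u 1) 0| := by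
  set N : Matrix (Fin 3) (Fin 3) ℝ := Matrix.of fun k i : Fin 3 => u i k with hN
  set M : Matrix (Fin 3) (Fin 3) ℝ := Matrix.of fun j k : Fin 3 => B j k with hM
  have hin : ∀ v w : E3, ⟪v, w⟫ = ∑ k, v k * w k := fun v w => by
    rw [EuclideanSpace.inner_fin_three, Fin.sum_univ_three]
  have hMN : ∀ j i, (M * N) j i = ⟪B j, u i⟫ := fun j i => by
    rw [Matrix.mul_apply, hin]; rfl
  have hMM : M * M.transpose = 1 := by
    ext j i
    rw [Matrix.mul_apply, Matrix.one_apply, ← orthonormal_iff_ite.1 B.orthonormal j i, hin]; rfl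
  have hM1 : |M.det| = 1 := by
    have := congrArg Matrix.det hMM
    rw [Matrix.det_mul, Matrix.det_transpose, Matrix.det_one, ← sq] at this
    rw [← Real.sqrt_sq_eq_abs, this, Real.sqrt_one]
  have h1 : |(M * N).det| = |N.det| := by rw [Matrix.det_mul, abs_mul, hM1, one_mul]
  rw [← h1, Matrix.det_fin_three]
  simp only [hMN, planeCoords_apply, ← hB]
  have e0 : ⟪B 0, B 2⟫ = 0 := B.orthonormal.2 (by decide)
  have e1 : ⟪B 1, B 2⟫ = 0 := B.orthonormal.2 (by decide)
  have e2 : ⟪B 2, B 2⟫ = 1 := by simp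
  rw [e0, e1, e2]
  congr 1
  change _ = ⟪B 0, u 0⟫ * ⟪B 1, u 1⟫ - ⟪B 1, u 0⟫ * ⟪B 0, u 1⟫
  ring

/-- The area of the projection of a slab intersection. -/
theorem volume_planeCoords_image_le {u : Fin 3 → E3} (hu : ∀ i, ‖u i‖ = 1) {θ : ℝ} (hθ : 0 < θ)
    (hdet : θ ≤ (Matrix.of fun k i : Fin 3 => u i k).det) (B : OrthonormalBasis (Fin 3) ℝ E3)
    (hB : B 2 = u 2) {A : Set E3} {z : E3} {δ : ℝ} (hδ : 0 ≤ δ)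
    (hA : ∀ x ∈ A, ∀ i, |⟪u i, x - z⟫| ≤ δ) :
    volume (planeCoords B '' A) ≤ ENNReal.ofReal (9 * Real.pi * δ ^ 2 / θ) := by
  set N : Matrix (Fin 2) (Fin 2) ℝ := !![planeCoords B (u 0) 0, planeCoords B (u 0) 1;
    planeCoords B (u 1) 0, planeCoords B (u 1) 1] with hN
  set L : E2 →ₗ[ℝ] E2 := N.toLpLin 2 2 with hL
  have hdet' : θ ≤ |L.det| := by
    rw [hL, LinearMap.det_toLpLin, Matrix.det_fin_two]
    have := abs_det_eq_planeCoords u B hB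
    simp only [hN, Matrix.of_apply, Matrix.cons_val', Matrix.cons_val_zero, Matrix.cons_val_one,
      Matrix.cons_val_fin_one]
    rw [← this]
    exact hdet.trans (le_abs_self _)
  -- `L` pairs a vector with the components of `u 0` and `u 1` orthogonal to `u 2`. The slab
  -- condition bounds each entry by 2δ, so the image lies in a disc of radius 3δ, and inverting `L`
  -- costs only 1/|det L| ≤ 1/θ in area.
  have hLapp : ∀ (w : E3) (i : Fin 2), L (planeCoords B w) i =
      ⟪u i.castSucc, w⟫ - ⟪u i.castSucc, u 2⟫ * ⟪u 2, w⟫ := by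
    intro w i
    have h1 := B.sum_inner_mul_inner (u i.castSucc) w
    rw [Fin.sum_univ_three, hB] at h1
    have h2 : ∀ j : Fin 2, planeCoords B w j = ⟪B j.castSucc, w⟫ := planeCoords_apply B w
    have h3 : ∀ k, ∀ j : Fin 2, planeCoords B (u k) j = ⟪u k, B j.castSucc⟫ := fun k j => by
      rw [planeCoords_apply, real_inner_comm]
    rw [← h1, hL, Matrix.toLpLin_apply]
    fin_cases i <;>
    · simp only [hN, Matrix.mulVec, dotProduct, Fin.sum_univ_two, h2, h3, Matrix.of_apply,
        Matrix.cons_val', Matrix.cons_val_zero, Matrix.cons_val_one, Matrix.cons_val_fin_one]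
      simp
  have hsub : planeCoords B '' A ⊆ L ⁻¹' Metric.closedBall (L (planeCoords B z)) (3 * δ) := by
    rintro _ ⟨x, hx, rfl⟩
    rw [mem_preimage, Metric.mem_closedBall, dist_eq_norm, ← map_sub, ← map_sub]
    have h1 : ∀ i : Fin 2, |L (planeCoords B (x - z)) i| ≤ 2 * δ := fun i => by
      rw [hLapp]
      have h2 : |⟪u i.castSucc, u 2⟫| ≤ 1 := by
        simpa [hu] using abs_real_inner_le_norm (u i.castSucc) (u 2)
      calc _ ≤ |⟪u i.castSucc, x - z⟫| + |⟪u i.castSucc, u 2⟫ * ⟪u 2, x - z⟫| := abs_sub _ _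
        _ ≤ δ + 1 * δ := by
          rw [abs_mul]
          gcongr
          · exact hA x hx _
          · exact hA x hx _
        _ = 2 * δ := by ring
    refine abs_le_of_sq_le_sq' ?_ (by positivity) |>.2
    rw [EuclideanSpace.real_norm_sq_eq, Fin.sum_univ_two]
    have h3 := sq_le_sq' (abs_le.1 (h1 0)).1 (abs_le.1 (h1 0)).2
    have h4 := sq_le_sq' (abs_le.1 (h1 1)).1 (abs_le.1 (h1 1)).2
    nlinarith
  have hdet0 : L.det ≠ 0 := abs_pos.1 (hθ.trans_le hdet')
  refine (measure_mono hsub).trans ?_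
  rw [Measure.addHaar_preimage_linearMap _ hdet0, EuclideanSpace.volume_closedBall_fin_two,
    ← ENNReal.ofReal_pow (by positivity), ← ENNReal.ofReal_mul (by positivity),
    ← ENNReal.ofReal_mul (by positivity)]
  refine ENNReal.ofReal_le_ofReal ?_
  rw [abs_inv, inv_mul_eq_div]
  rw [show (3 * δ) ^ 2 * Real.pi = 9 * Real.pi * δ ^ 2 by ring]
  gcongr

/-! ### Area of the near-intersection of three surfaces -/

theorem IsHolderSurface.abs_inner_normal_le_of_near {β b : ℝ} {S Sstar : Set E3} {n : E3 → E3}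
    (hS : IsHolderSurface β b S Sstar n) (hb : 0 < b) (hβ : 0 < β) {p q v : E3} {δ : ℝ}
    (hp : p ∈ Sstar) (hq : q ∈ Sstar) (hv : ‖v - (p - q)‖ ≤ δ) :
    |⟪n p, v⟫| ≤ δ + b * (‖v‖ + δ) ^ (1 + β) := by
  have h1 : ⟪n p, v⟫ = ⟪n p, v - (p - q)⟫ + ⟪n p, p - q⟫ := by rw [← inner_add_right]; simp
  rw [h1]
  refine (abs_add_le _ _).trans (add_le_add ?_ ?_)
  · refine (abs_real_inner_le_norm _ _).trans ?_
    rw [hS.norm_normal hp, one_mul]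
    exact hv
  · refine (hS.abs_inner_normal_le hb hp hq).trans ?_
    gcongr
    have h2 : p - q = v - (v - (p - q)) := by abel
    rw [h2]
    exact (norm_sub_le _ _).trans (by gcongr)

/-- For d > 2ε one has (d + 2ε)^(1+β) ≤ 4 d^(1+β), so the Hölder terms total at most 9 b d^(1+β) ≤
(9/24) θ d. This is less than half of the left side, and absorbing it leaves d ≤ 8ε/θ. -/
theorem le_div_of_mul_le_add_rpow {β b θ ε d : ℝ} (hβ : 0 < β) (hβ1 : β ≤ 1) (hb : 0 < b)
    (hθ : 0 < θ) (hθ1 : θ ≤ 1) (hε : 0 < ε) (hd : 0 ≤ d)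
    (h : θ * d ≤ 4 * ε + 2 * (b * (d + 2 * ε) ^ (1 + β)) + b * d ^ (1 + β))
    (hbd : 24 * (b * d ^ β) ≤ θ) : d ≤ 8 * ε / θ := by
  rw [le_div_iff₀ hθ]
  rcases le_or_gt d (2 * ε) with h1 | h1
  · nlinarith
  have hmul : ∀ s : ℝ, 0 ≤ s → s ^ (1 + β) = s * s ^ β := fun s hs => by
    rw [Real.rpow_add' hs (by positivity), Real.rpow_one]
  have h2 : (d + 2 * ε) ^ (1 + β) ≤ 4 * (d * d ^ β) := by
    calc (d + 2 * ε) ^ (1 + β) ≤ (2 * d) ^ (1 + β) :=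
          Real.rpow_le_rpow (by positivity) (by linarith) (by positivity)
      _ = 2 ^ (1 + β) * d ^ (1 + β) := Real.mul_rpow (by norm_num) hd
      _ ≤ 2 ^ (2 : ℝ) * d ^ (1 + β) := by
        gcongr
        · norm_num
        · linarith
      _ = 4 * (d * d ^ β) := by rw [hmul d hd]; norm_num
  rw [hmul d hd] at h
  have h3 : b * (d + 2 * ε) ^ (1 + β) ≤ b * (4 * (d * d ^ β)) := by gcongr
  have h4 : 24 * (b * d ^ β) * d ≤ θ * d := by gcongr
  nlinarith

/-- The points `z` of `S 2` such that `z - x` is close to `S 1` and `z - y` is close to `S 0`. -/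
def nearSumSet (S : Fin 3 → Set E3) (ε : ℝ) (x y : E3) : Set E3 :=
  {z | z ∈ S 2 ∧ (∃ p ∈ S 1, ‖z - x - p‖ < ε) ∧ ∃ q ∈ S 0, ‖z - y - q‖ < ε}

section Transversal

variable {β b θ : ℝ} {S Sstar : Fin 3 → Set E3} {n : Fin 3 → E3 → E3}

/-- Two passes. Transversality first bounds the diameter by 8ε/θ. At that scale `hbε` makes every
Hölder error at most ε, so the cluster lies in three slabs of half-width 3ε, and the constant is 4 ·
9π · 3² = 324π. -/
theorem measure_cluster_le (hS : ∀ i, IsHolderSurface β b (S i) (Sstar i) (n i))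
    (hdet : ∀ x : Fin 3 → E3, (∀ i, x i ∈ Sstar i) →
      θ ≤ (Matrix.of fun k i : Fin 3 => n i (x i) k).det)
    (hβ : 0 < β) (hβ1 : β ≤ 1) (hb : 0 < b) (hθ : 0 < θ) (hθ1 : θ ≤ 1) {ε : ℝ} (hε : 0 < ε)
    (hbε : b * (10 / θ) * (10 / θ * ε) ^ β ≤ 1) (x y : E3) {A : Set E3}
    (hA : A ⊆ nearSumSet S ε x y)
    (hAd : ∀ z ∈ A, ∀ w ∈ A, 24 * (b * ‖z - w‖ ^ β) ≤ θ) :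
    μHE[2] A ≤ ENNReal.ofReal (324 * Real.pi * ε ^ 2 / θ) := by
  rcases A.eq_empty_or_nonempty with rfl | ⟨z₀, hz₀⟩
  · simp
  have hmul : ∀ s : ℝ, 0 ≤ s → s ^ (1 + β) = s * s ^ β := fun s hs => by
    rw [Real.rpow_add' hs (by positivity), Real.rpow_one]
  have hnear : ∀ {c z p z' p' : E3}, ‖z - c - p‖ < ε → ‖z' - c - p'‖ < ε →
      ‖(z - z') - (p - p')‖ ≤ 2 * ε := by
    intro c z p z' p' h1 h2
    have h3 : (z - z') - (p - p') = (z - c - p) - (z' - c - p') := by abel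
    rw [h3]
    linarith [norm_sub_le (z - c - p) (z' - c - p')]
  have hin2 : ∀ z ∈ A, ∀ w ∈ A, |⟪n 2 z, z - w⟫| ≤ b * ‖z - w‖ ^ (1 + β) := fun z hz w hw =>
    (hS 2).abs_inner_normal_le hb ((hS 2).subset (hA hz).1) ((hS 2).subset (hA hw).1)
  have hdiam : ∀ z ∈ A, ∀ w ∈ A, ‖z - w‖ ≤ 8 * ε / θ := by
    intro z hz w hw
    obtain ⟨hz2, ⟨p, hp, hzp⟩, q, hq, hzq⟩ := hA hz
    obtain ⟨hw2, ⟨p', hp', hwp⟩, q', hq', hwq⟩ := hA hw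
    have h1 := (hS 1).abs_inner_normal_le_of_near hb hβ ((hS 1).subset hp) ((hS 1).subset hp')
      (hnear hzp hwp)
    have h0 := (hS 0).abs_inner_normal_le_of_near hb hβ ((hS 0).subset hq) ((hS 0).subset hq')
      (hnear hzq hwq)
    have h2 := hin2 z hz w hw
    have hmem : ∀ i, (![q, p, z] : Fin 3 → E3) i ∈ Sstar i := by
      intro i
      fin_cases i
      exacts [(hS 0).subset hq, (hS 1).subset hp, (hS 2).subset hz2]
    have h3 := norm_mul_det_le (u := fun i => n i ((![q, p, z] : Fin 3 → E3) i))
      (fun i => (hS i).norm_normal (hmem i)) (hdet _ hmem) (z - w)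
    simp only [Matrix.cons_val_zero, Matrix.cons_val_one, Matrix.cons_val] at h3
    refine le_div_of_mul_le_add_rpow hβ hβ1 hb hθ hθ1 hε (norm_nonneg _) ?_ (hAd z hz w hw)
    linarith
  obtain ⟨hz2, ⟨p, hp, hzp⟩, q, hq, hzq⟩ := hA hz₀
  have hmem : ∀ i, (![q, p, z₀] : Fin 3 → E3) i ∈ Sstar i := by
    intro i
    fin_cases i
    exacts [(hS 0).subset hq, (hS 1).subset hp, (hS 2).subset hz2]
  have hb10 : b * (10 / θ * ε) ^ (1 + β) ≤ ε := by
    rw [hmul _ (by positivity)]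
    calc b * (10 / θ * ε * (10 / θ * ε) ^ β) = b * (10 / θ) * (10 / θ * ε) ^ β * ε := by ring
      _ ≤ 1 * ε := by gcongr
      _ = ε := one_mul _
  have hle8 : 8 * ε / θ ≤ 10 / θ * ε := by
    rw [div_mul_eq_mul_div]; gcongr; norm_num
  have hle10 : 8 * ε / θ + 2 * ε ≤ 10 / θ * ε := by
    have : 2 * ε ≤ 2 * ε / θ := by
      rw [le_div_iff₀ hθ]; nlinarith
    calc 8 * ε / θ + 2 * ε ≤ 8 * ε / θ + 2 * ε / θ := by gcongr
      _ = _ := by ring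
  have hpow : ∀ s : ℝ, 0 ≤ s → s ≤ 10 / θ * ε → b * s ^ (1 + β) ≤ ε := fun s h0 h1 =>
    le_trans (by gcongr) hb10
  have hsl : ∀ w ∈ A, ∀ i, |⟪n i ((![q, p, z₀] : Fin 3 → E3) i), w - z₀⟫| ≤ 3 * ε := by
    intro w hw i
    rw [← neg_sub, inner_neg_right, abs_neg]
    obtain ⟨hw2, ⟨p', hp', hwp⟩, q', hq', hwq⟩ := hA hw
    have hd := hdiam z₀ hz₀ w hw
    have hb2 : b * (‖z₀ - w‖ + 2 * ε) ^ (1 + β) ≤ ε :=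
      hpow _ (by positivity) (by linarith)
    fin_cases i
    · exact ((hS 0).abs_inner_normal_le_of_near hb hβ ((hS 0).subset hq) ((hS 0).subset hq')
        (hnear hzq hwq)).trans (by linarith)
    · exact ((hS 1).abs_inner_normal_le_of_near hb hβ ((hS 1).subset hp) ((hS 1).subset hp')
        (hnear hzp hwp)).trans (by linarith)
    · exact (hin2 z₀ hz₀ w hw).trans ((hpow _ (by positivity) (hd.trans hle8)).trans (by linarith))
  obtain ⟨B, hB⟩ := exists_orthonormalBasis_last_eq ((hS 2).norm_normal ((hS 2).subset hz2))
  have hbd : 4 * b * (8 * ε / θ) ^ β ≤ 1 := by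
    have h10 : 4 ≤ 10 / θ := by rw [le_div_iff₀ hθ]; linarith
    calc 4 * b * (8 * ε / θ) ^ β ≤ b * (10 / θ) * (10 / θ * ε) ^ β := by
          rw [mul_comm 4 b]; gcongr
      _ ≤ 1 := hbε
  refine ((hS 2).area_le hb hβ (fun w hw => (hS 2).subset (hA hw).1) hz₀ hdiam hbd hB).trans ?_
  have hvol := volume_planeCoords_image_le
    (u := fun i => n i ((![q, p, z₀] : Fin 3 → E3) i))
    (fun i => (hS i).norm_normal (hmem i)) hθ (hdet _ hmem) B hB (by positivity) hsl
  calc 4 * volume (planeCoords B '' A)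
      ≤ 4 * ENNReal.ofReal (9 * Real.pi * (3 * ε) ^ 2 / θ) := by gcongr
    _ = _ := by
      rw [show (4 : ℝ≥0∞) = ENNReal.ofReal 4 by simp, ← ENNReal.ofReal_mul (by positivity)]
      congr 1
      ring

/-- The number of small balls needed to cover a set, uniformly under scaling. -/
theorem exists_finset_cover {ρ : ℝ} (hρ : 0 < ρ) :
    ∃ F : Finset E3, ∀ (R : ℝ) (z₀ z : E3), ‖z - z₀‖ ≤ R →
      ∃ c ∈ F, ‖z - (z₀ + R • c)‖ ≤ R * ρ := by
  obtain ⟨t, ht, hcov⟩ := Metric.totallyBounded_iff.1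
    (isCompact_closedBall (0 : E3) 1).totallyBounded ρ hρ
  refine ⟨ht.toFinset, fun R z₀ z hz => ?_⟩
  have hR : 0 ≤ R := (norm_nonneg _).trans hz
  -- For `R = 0` the convention `R⁻¹ = 0` sends everything to the origin, and then `z = z₀`.
  have h1 : R⁻¹ • (z - z₀) ∈ Metric.closedBall (0 : E3) 1 := by
    rw [mem_closedBall_zero_iff, norm_smul, norm_inv, Real.norm_of_nonneg hR]
    rcases hR.eq_or_lt with h | h
    · simp [← h]
    · rw [inv_mul_le_iff₀ h]; linarith
  obtain ⟨c, hc, hcz⟩ := mem_iUnion₂.1 (hcov h1)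
  refine ⟨c, by simpa using hc, ?_⟩
  have h2 : z - (z₀ + R • c) = R • (R⁻¹ • (z - z₀) - c) := by
    rcases hR.eq_or_lt with h | h
    · rw [← h] at hz ⊢
      simp [norm_le_zero_iff.1 hz]
    · rw [smul_sub, smul_inv_smul₀ h.ne']; abel
  rw [h2, norm_smul, Real.norm_of_nonneg hR, ← dist_eq_norm]
  exact mul_le_mul_of_nonneg_left (le_of_lt hcz) hR

theorem exists_measure_nearSumSet_le (β : ℝ) (hβ : 0 < β) (hβ1 : β ≤ 1) :
    ∃ N : ℕ, ∀ (b θ R : ℝ) (S Sstar : Fin 3 → Set E3) (n : Fin 3 → E3 → E3),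
      (∀ i, IsHolderSurface β b (S i) (Sstar i) (n i)) →
      (∀ x : Fin 3 → E3, (∀ i, x i ∈ Sstar i) →
        θ ≤ (Matrix.of fun k i : Fin 3 => n i (x i) k).det) →
      0 < b → 0 < θ → θ ≤ 1 → Metric.diam (S 2) ≤ R → R ^ β * b ≤ θ →
      ∃ ε₀ : ℝ, 0 < ε₀ ∧ ∀ ε, 0 < ε → ε ≤ ε₀ → ∀ x y,
        μHE[2] (nearSumSet S ε x y) ≤ ENNReal.ofReal (N * (324 * Real.pi * ε ^ 2 / θ)) := by
  -- Two points of a cell of radius `R * ρ` are at most 2ρR apart, and (2ρ)^β = 1/24 turns `R ^ β *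
  -- b ≤ θ` into the smallness needed in each cluster. The number of cells depends on `β` only.
  set ρ : ℝ := (1 / 24) ^ (1 / β) / 2 with hρ
  have hρ0 : 0 < ρ := by positivity
  have hρβ : (2 * ρ) ^ β = 1 / 24 := by
    rw [hρ, mul_div_cancel₀ _ two_ne_zero, ← Real.rpow_mul (by norm_num), one_div_mul_cancel hβ.ne',
      Real.rpow_one]
  obtain ⟨F, hF⟩ := exists_finset_cover hρ0
  refine ⟨F.card, fun b θ R S Sstar n hS hdet hb hθ hθ1 hR hRb => ?_⟩
  obtain ⟨ε₀, hε₀, hε⟩ := exists_pos_mul_rpow_le (10 / θ) (b * (10 / θ)) hβ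
  refine ⟨ε₀, hε₀, fun ε h0 h1 x y => ?_⟩
  obtain ⟨z₀, hz₀⟩ := (hS 2).nonempty
  have hcov : nearSumSet S ε x y ⊆
      ⋃ c ∈ F, (nearSumSet S ε x y ∩ {z | ‖z - (z₀ + R • c)‖ ≤ R * ρ}) := by
    intro z hz
    have h2 : ‖z - z₀‖ ≤ R := by
      rw [← dist_eq_norm]
      exact (Metric.dist_le_diam_of_mem (hS 2).bounded hz.1 hz₀).trans hR
    obtain ⟨c, hc, hcz⟩ := hF R z₀ z h2
    exact mem_iUnion₂.2 ⟨c, hc, hz, hcz⟩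
  have hR0 : 0 ≤ R := Metric.diam_nonneg.trans hR
  calc μHE[2] (nearSumSet S ε x y) ≤ _ := measure_mono hcov
    _ ≤ ∑ c ∈ F, μHE[2] (nearSumSet S ε x y ∩ {z | ‖z - (z₀ + R • c)‖ ≤ R * ρ}) :=
      measure_biUnion_finset_le _ _
    _ ≤ ∑ c ∈ F, ENNReal.ofReal (324 * Real.pi * ε ^ 2 / θ) := by
      refine Finset.sum_le_sum fun c _ => measure_cluster_le hS hdet hβ hβ1 hb hθ hθ1 h0
        (hε ε h0 h1) x y inter_subset_left fun z hz w hw => ?_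
      have h3 : ‖z - w‖ ≤ R * (2 * ρ) := by
        have h4 : z - w = (z - (z₀ + R • c)) - (w - (z₀ + R • c)) := by abel
        rw [h4]
        refine (norm_sub_le _ _).trans ?_
        have h5 : ‖z - (z₀ + R • c)‖ ≤ R * ρ := hz.2
        have h6 : ‖w - (z₀ + R • c)‖ ≤ R * ρ := hw.2
        linarith
      calc 24 * (b * ‖z - w‖ ^ β) ≤ 24 * (b * (R * (2 * ρ)) ^ β) := by gcongr
        _ = R ^ β * b := by rw [Real.mul_rpow hR0 (by positivity), hρβ]; ring
        _ ≤ θ := hRb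
    _ = _ := by
      rw [Finset.sum_const, nsmul_eq_mul, ENNReal.ofReal_mul (by positivity)]
      simp

end Transversal

/-! ### Cauchy–Schwarz and the trilinear kernel -/

theorem sq_lintegral_mul_le {α : Type*} [MeasurableSpace α] (μ : Measure α) {f g κ : α → ℝ≥0∞}
    (hf : Measurable f) (hg : Measurable g) (hκ : Measurable κ) :
    (∫⁻ x, f x * g x * κ x ∂μ) ^ 2 ≤ (∫⁻ x, f x ^ 2 * κ x ∂μ) * ∫⁻ x, g x ^ 2 * κ x ∂μ := by
  have h1 := ENNReal.lintegral_mul_le_Lp_mul_Lq (μ.withDensity κ) Real.HolderConjugate.two_two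
    hf.aemeasurable hg.aemeasurable
  rw [lintegral_withDensity_eq_lintegral_mul _ hκ (hf.mul hg),
    lintegral_withDensity_eq_lintegral_mul _ hκ (hf.pow_const _),
    lintegral_withDensity_eq_lintegral_mul _ hκ (hg.pow_const _)] at h1
  simp only [Pi.mul_apply, ENNReal.rpow_two, mul_comm (κ _)] at h1
  calc _ ≤ _ := pow_le_pow_left' h1 2
    _ = _ := by
      rw [mul_pow, ← ENNReal.rpow_natCast, ← ENNReal.rpow_natCast, ← ENNReal.rpow_mul,
        ← ENNReal.rpow_mul]
      norm_num

/-- Cauchy–Schwarz puts f² and g² in separate factors, each still carrying κ. Integrating the unused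
variable yields f(x)² D₁(z - x) and g(y)² D₀(z - y), and by Tonelli the z-integral of D₁ D₀ is taken
first. -/
theorem lintegral_sq_convolution_le {S₀ S₁ S₂ : Set E3} {μ₀ : Measure S₀} {μ₁ : Measure S₁}
    {μ₂ : Measure S₂} [SFinite μ₀] [SFinite μ₁] [SFinite μ₂] {κ : E3 → ℝ≥0∞} (hκ : Measurable κ)
    {M : ℝ≥0∞} (hM : ∀ x y : E3, ∫⁻ z : S₂, (∫⁻ p : S₁, κ (z - x - p) ∂μ₁) *
      ∫⁻ q : S₀, κ (z - y - q) ∂μ₀ ∂μ₂ ≤ M)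
    {f : S₀ → ℝ≥0∞} {g : S₁ → ℝ≥0∞} (hf : Measurable f) (hg : Measurable g) :
    ∫⁻ z : S₂, (∫⁻ w : S₀ × S₁, f w.1 * g w.2 * κ (z - w.1 - w.2) ∂(μ₀.prod μ₁)) ^ 2 ∂μ₂ ≤
      M * ((∫⁻ x, f x ^ 2 ∂μ₀) * ∫⁻ y, g y ^ 2 ∂μ₁) := by
  set D₁ : E3 → ℝ≥0∞ := fun v => ∫⁻ p : S₁, κ (v - p) ∂μ₁ with hD₁
  set D₀ : E3 → ℝ≥0∞ := fun v => ∫⁻ q : S₀, κ (v - q) ∂μ₀ with hD₀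
  have mD₁ : Measurable D₁ := by
    apply Measurable.lintegral_prod_right
    exact hκ.comp (measurable_fst.sub (measurable_subtype_coe.comp measurable_snd))
  have mD₀ : Measurable D₀ := by
    apply Measurable.lintegral_prod_right
    exact hκ.comp (measurable_fst.sub (measurable_subtype_coe.comp measurable_snd))
  have m2 : Measurable fun w : S₀ × S₁ => f w.1 ^ 2 := (hf.comp measurable_fst).pow_const 2
  have m3 : Measurable fun w : S₀ × S₁ => g w.2 ^ 2 := (hg.comp measurable_snd).pow_const 2
  have h1 : ∀ z : S₂, (∫⁻ w : S₀ × S₁, f w.1 * g w.2 * κ (z - w.1 - w.2) ∂(μ₀.prod μ₁)) ^ 2 ≤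
      ∫⁻ w : S₀ × S₁, (f w.1 ^ 2 * D₁ (z - w.1)) * (g w.2 ^ 2 * D₀ (z - w.2)) ∂(μ₀.prod μ₁) := by
    intro z
    have mκ : Measurable fun w : S₀ × S₁ => κ (z - w.1 - w.2) := hκ.comp (by fun_prop)
    refine (sq_lintegral_mul_le (μ₀.prod μ₁) (f := fun w => f w.1) (g := fun w => g w.2)
      (hf.comp measurable_fst) (hg.comp measurable_snd) mκ).trans_eq ?_
    have m4 : Measurable fun w : S₀ × S₁ => f w.1 ^ 2 * κ (z - w.1 - w.2) := m2.mul mκ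
    have m5 : Measurable fun w : S₀ × S₁ => g w.2 ^ 2 * κ (z - w.1 - w.2) := m3.mul mκ
    rw [lintegral_prod _ m4.aemeasurable, lintegral_prod_symm _ m5.aemeasurable,
      lintegral_prod_mul (f := fun x : S₀ => f x ^ 2 * D₁ (z - x))
        (g := fun y : S₁ => g y ^ 2 * D₀ (z - y))]
    · congr 1
      · refine lintegral_congr fun x => ?_
        have m6 : Measurable fun y : S₁ => κ (z - x - y) := hκ.comp (by fun_prop)
        exact lintegral_const_mul (f x ^ 2) m6
      · refine lintegral_congr fun y => ?_
        have m6 : Measurable fun x : S₀ => κ (z - y - x) := hκ.comp (by fun_prop)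
        rw [hD₀, ← lintegral_const_mul _ m6]
        refine lintegral_congr fun x => ?_
        rw [sub_right_comm]
    · exact ((hf.pow_const 2).mul (mD₁.comp (by fun_prop))).aemeasurable
    · exact ((hg.pow_const 2).mul (mD₀.comp (by fun_prop))).aemeasurable
  have mA : Measurable fun v : S₂ × (S₀ × S₁) => D₁ (v.1 - v.2.1) := mD₁.comp (by fun_prop)
  have mB : Measurable fun v : S₂ × (S₀ × S₁) => D₀ (v.1 - v.2.2) := mD₀.comp (by fun_prop)
  calc _ ≤ _ := lintegral_mono h1
    _ = ∫⁻ w : S₀ × S₁, ∫⁻ z : S₂, (f w.1 ^ 2 * D₁ (z - w.1)) * (g w.2 ^ 2 * D₀ (z - w.2))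
        ∂μ₂ ∂(μ₀.prod μ₁) := by
      refine lintegral_lintegral_swap (Measurable.aemeasurable ?_)
      exact ((m2.comp measurable_snd).mul mA).mul ((m3.comp measurable_snd).mul mB)
    _ ≤ ∫⁻ w : S₀ × S₁, M * (f w.1 ^ 2 * g w.2 ^ 2) ∂(μ₀.prod μ₁) := by
      refine lintegral_mono fun w => ?_
      have h2 : ∀ z : S₂, (f w.1 ^ 2 * D₁ (z - w.1)) * (g w.2 ^ 2 * D₀ (z - w.2)) =
          (f w.1 ^ 2 * g w.2 ^ 2) * (D₁ (z - w.1) * D₀ (z - w.2)) := fun z => by ring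
      simp only [h2]
      have m4 : Measurable fun z : S₂ => D₁ (z - w.1) * D₀ (z - w.2) :=
        (mD₁.comp (by fun_prop)).mul (mD₀.comp (by fun_prop))
      rw [lintegral_const_mul _ m4, mul_comm]
      gcongr
      exact hM _ _
    _ = _ := by
      have m4 : Measurable fun w : S₀ × S₁ => f w.1 ^ 2 * g w.2 ^ 2 := m2.mul m3
      rw [lintegral_const_mul _ m4, lintegral_prod_mul (f := fun x : S₀ => f x ^ 2)
        (g := fun y : S₁ => g y ^ 2) (hf.pow_const 2).aemeasurable (hg.pow_const 2).aemeasurable]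

theorem lintegral_mollifier_le {S : Set E3} {μ : Measure S} {η : E3 → ℝ} {c m ε : ℝ} (hc : 0 ≤ c)
    (hη : ∀ v, η v ≤ c) (hηs : ∀ v, ε ≤ ‖v‖ → η v = 0)
    (hμ : ∀ w : E3, μ {p : S | ‖w - p‖ < ε} ≤ ENNReal.ofReal m) (w : E3) :
    ∫⁻ p : S, ENNReal.ofReal (η (w - p)) ∂μ ≤ ENNReal.ofReal (c * m) := by
  calc ∫⁻ p : S, ENNReal.ofReal (η (w - p)) ∂μ
      ≤ ∫⁻ p : S, {p : S | ‖w - p‖ < ε}.indicator (fun _ => ENNReal.ofReal c) p ∂μ := by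
        refine lintegral_mono fun p => ?_
        by_cases hp : ‖w - p‖ < ε
        · rw [indicator_of_mem (by exact hp)]
          exact ENNReal.ofReal_le_ofReal (hη _)
        · rw [hηs _ (not_lt.1 hp)]
          simp
    _ ≤ ENNReal.ofReal c * μ {p : S | ‖w - p‖ < ε} := lintegral_indicator_const_le _ _
    _ ≤ ENNReal.ofReal c * ENNReal.ofReal m := by gcongr; exact hμ w
    _ = _ := (ENNReal.ofReal_mul hc).symm

/-- The trilinear kernel bound for mollified surface measures. -/
theorem exists_kernel_bound (β : ℝ) (hβ : 0 < β) (hβ1 : β ≤ 1) :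
    ∃ M : ℝ, 0 ≤ M ∧ ∀ (b θ R : ℝ) (S Sstar : Fin 3 → Set E3) (n : Fin 3 → E3 → E3),
      (∀ i, IsHolderSurface β b (S i) (Sstar i) (n i)) →
      (∀ x : Fin 3 → E3, (∀ i, x i ∈ Sstar i) →
        θ ≤ (Matrix.of fun k i : Fin 3 => n i (x i) k).det) →
      0 < b → 0 < θ → θ ≤ 1 → Metric.diam (S 2) ≤ R → R ^ β * b ≤ θ →
      ∃ ε₀ : ℝ, 0 < ε₀ ∧ ∀ ε, 0 < ε → ε ≤ ε₀ → ∀ η : E3 → ℝ,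
        (∀ v, η v ≤ 6 / (Real.pi * ε ^ 3)) → (∀ v, ε ≤ ‖v‖ → η v = 0) → ∀ x y : E3,
          ∫⁻ z : S 2, (∫⁻ p : S 1, ENNReal.ofReal (η (z - x - p)) ∂(surfaceMeasure (S 1))) *
            ∫⁻ q : S 0, ENNReal.ofReal (η (z - y - q)) ∂(surfaceMeasure (S 0))
              ∂(surfaceMeasure (S 2)) ≤ ENNReal.ofReal (M / θ) := by
  obtain ⟨N, hN⟩ := exists_measure_nearSumSet_le β hβ hβ1
  -- Two factors 96/ε bound the mollified surface measures and N · 324πε²/θ bounds the area of their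
  -- common support on `S 2`; the powers of ε cancel.
  refine ⟨96 * 96 * (N * (324 * Real.pi)), by positivity,
    fun b θ R S Sstar n hS hdet hb hθ hθ1 hR hRb => ?_⟩
  obtain ⟨ε₁, hε₁, h₁⟩ := hN b θ R S Sstar n hS hdet hb hθ hθ1 hR hRb
  obtain ⟨ε₂, hε₂, h₂⟩ := exists_pos_mul_rpow_le 2 (4 * b) hβ
  refine ⟨min ε₁ ε₂, lt_min hε₁ hε₂, fun ε hε hεle η hη hηs x y => ?_⟩
  have hc : (0 : ℝ) ≤ 6 / (Real.pi * ε ^ 3) := by positivity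
  -- The constant is the height 6/(πε³) of the mollifier times the area 16πε² of the surface in an
  -- ε-ball.
  have hD : ∀ i, ∀ w : E3, ∫⁻ p : S i, ENNReal.ofReal (η (w - p)) ∂(surfaceMeasure (S i)) ≤
      ENNReal.ofReal (96 / ε) := by
    intro i w
    refine (lintegral_mollifier_le hc hη hηs (fun w => (hS i).surfaceMeasure_ball_le hb hβ hε
      (h₂ ε hε (hεle.trans (min_le_right _ _))) w) w).trans_eq ?_
    congr 1
    field_simp
    norm_num
  have hD0 : ∀ i, ∀ w : E3, (¬ ∃ p ∈ S i, ‖w - p‖ < ε) →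
      ∫⁻ p : S i, ENNReal.ofReal (η (w - p)) ∂(surfaceMeasure (S i)) = 0 := by
    intro i w hw
    push Not at hw
    rw [lintegral_congr (g := fun _ => 0) fun p => by rw [hηs _ (hw p p.2), ENNReal.ofReal_zero]]
    exact lintegral_zero
  set Z : Set (S 2) := {z : S 2 | (z : E3) ∈ nearSumSet S ε x y} with hZ
  have hZm : surfaceMeasure (S 2) Z ≤ ENNReal.ofReal (N * (324 * Real.pi * ε ^ 2 / θ)) := by
    rw [surfaceMeasure_apply]
    refine (measure_mono ?_).trans (h₁ ε hε (hεle.trans (min_le_left _ _)) x y)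
    rintro _ ⟨z, hz, rfl⟩
    exact hz
  calc _ ≤ ∫⁻ z : S 2, Z.indicator (fun _ => ENNReal.ofReal (96 / ε) * ENNReal.ofReal (96 / ε)) z
        ∂(surfaceMeasure (S 2)) := by
        refine lintegral_mono fun z => ?_
        by_cases hz : z ∈ Z
        · rw [indicator_of_mem hz]
          exact mul_le_mul' (hD 1 _) (hD 0 _)
        · rw [indicator_of_notMem hz]
          by_cases hp : ∃ p ∈ S 1, ‖(z : E3) - x - p‖ < ε
          · have hq : ¬ ∃ q ∈ S 0, ‖(z : E3) - y - q‖ < ε := fun hq => hz ⟨z.2, hp, hq⟩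
            rw [hD0 0 _ hq, mul_zero]
          · rw [hD0 1 _ hp, zero_mul]
    _ ≤ ENNReal.ofReal (96 / ε) * ENNReal.ofReal (96 / ε) * surfaceMeasure (S 2) Z :=
      lintegral_indicator_const_le _ _
    _ ≤ ENNReal.ofReal (96 / ε) * ENNReal.ofReal (96 / ε) *
        ENNReal.ofReal (N * (324 * Real.pi * ε ^ 2 / θ)) := by gcongr
    _ = _ := by
      rw [← ENNReal.ofReal_mul (by positivity), ← ENNReal.ofReal_mul (by positivity)]
      congr 1
      field_simp

/-! ### The L² bound for compactly supported functions -/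

/-- The standard mollifier at scale `ε`. -/
noncomputable def mollifier (ε : ℝ) (hε : 0 < ε) : ContDiffBump (0 : E3) :=
  ⟨ε / 2, ε, by positivity, by linarith⟩

theorem mollifier_normed_le {ε : ℝ} (hε : 0 < ε) (v : E3) :
    (mollifier ε hε).normed volume v ≤ 6 / (Real.pi * ε ^ 3) := by
  refine ((mollifier ε hε).normed_le_div_measure_closedBall_rIn volume v).trans_eq ?_
  change 1 / (volume : Measure E3).real (Metric.closedBall 0 (ε / 2)) = _
  rw [measureReal_def, EuclideanSpace.volume_closedBall_fin_three,
    ← ENNReal.ofReal_pow (by positivity), ← ENNReal.ofReal_mul (by positivity),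
    ENNReal.toReal_ofReal (by positivity)]
  field_simp
  norm_num

theorem mollifier_normed_eq_zero {ε : ℝ} (hε : 0 < ε) (v : E3) (hv : ε ≤ ‖v‖) :
    (mollifier ε hε).normed volume v = 0 := by
  by_contra h
  have h1 : v ∈ Function.support ((mollifier ε hε).normed volume) := h
  rw [ContDiffBump.support_normed_eq, mem_ball_zero_iff] at h1
  exact absurd h1 (not_lt.2 hv)

theorem eLpNorm_two_sq {α E : Type*} [MeasurableSpace α] [NormedAddCommGroup E] (μ : Measure α)
    (f : α → E) : eLpNorm f 2 μ ^ 2 = ∫⁻ x, ‖f x‖ₑ ^ 2 ∂μ := by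
  have := eLpNorm_nnreal_pow_eq_lintegral (μ := μ) (f := f) (p := 2) two_ne_zero
  simpa [ENNReal.rpow_two] using this

section Representation

variable {S₁ S₂ : Set E3}

/-- The representation is tested with the function w ↦ η(z - w), and absolute values are taken
inside. -/
theorem enorm_mollified_le [SFinite (surfaceMeasure S₁)] [SFinite (surfaceMeasure S₂)]
    {f : S₁ → ℂ} {g : S₂ → ℂ} {F : E3 → ℂ} (hf : Continuous f) (hg : Continuous g)
    (h : RepresentsConvolution f g F) {ε : ℝ}
    (hε : 0 < ε) (z : E3) :
    ‖∫ w, (mollifier ε hε).normed volume (z - w) • F w‖ₑ ≤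
      ∫⁻ w : S₁ × S₂, ‖f w.1‖ₑ * ‖g w.2‖ₑ *
        ENNReal.ofReal ((mollifier ε hε).normed volume (z - w.1 - w.2))
          ∂((surfaceMeasure S₁).prod (surfaceMeasure S₂)) := by
  set η := (mollifier ε hε).normed (volume : Measure E3) with hη
  have hηc : ContDiff ℝ ∞ η := (mollifier ε hε).contDiff_normed
  have hη0 : ∀ v, 0 ≤ η v := (mollifier ε hε).nonneg_normed
  have hrep := h (fun w => (η (z - w) : ℂ))
    (Complex.ofRealCLM.contDiff.comp (hηc.comp (contDiff_const.sub contDiff_id))) (by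
      have h1 : HasCompactSupport fun w => η (z - w) :=
        (mollifier ε hε).hasCompactSupport_normed.comp_homeomorph (Homeomorph.subLeft z)
      exact h1.comp_left (g := fun x : ℝ => (x : ℂ)) Complex.ofReal_zero)
  have h2 : ∫ w, η (z - w) • F w = ∫ w, F w * (η (z - w) : ℂ) :=
    integral_congr_ae (Eventually.of_forall fun w => by
      simp only [Complex.real_smul, mul_comm])
  have hmeas : Measurable fun w : S₁ × S₂ =>
      ‖f w.1‖ₑ * ‖g w.2‖ₑ * ENNReal.ofReal (η (z - w.1 - w.2)) := by
    refine ((hf.comp continuous_fst).enorm.measurable.mul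
      (hg.comp continuous_snd).enorm.measurable).mul ?_
    exact ENNReal.measurable_ofReal.comp (hηc.continuous.comp (by fun_prop)).measurable
  rw [h2, hrep, lintegral_prod _ hmeas.aemeasurable]
  refine (enorm_integral_le_lintegral_enorm _).trans (lintegral_mono fun x => ?_)
  refine (enorm_integral_le_lintegral_enorm _).trans_eq (lintegral_congr fun y => ?_)
  rw [enorm_mul, enorm_mul, ← sub_sub]
  congr 1
  rw [← ofReal_norm, Complex.norm_real, Real.norm_of_nonneg (hη0 _)]

theorem tendsto_mollified {F : E3 → ℂ} (hF : Continuous F) {ε : ℕ → ℝ} (hε : ∀ k, 0 < ε k)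
    (hlim : Tendsto ε atTop (𝓝 0)) (z : E3) :
    Tendsto (fun k => ∫ w, (mollifier (ε k) (hε k)).normed volume (z - w) • F w) atTop
      (𝓝 (F z)) := by
  have h := ContDiffBump.convolution_tendsto_right_of_continuous (μ := (volume : Measure E3))
    (φ := fun k => mollifier (ε k) (hε k)) hlim hF z
  refine h.congr fun k => ?_
  rw [convolution_eq_swap]
  rfl

end Representation

/-- `S₂` is a null set for Lebesgue measure, so `F` is reached there through its mollifications.
They converge pointwise by continuity, their L² bounds are uniform in ε, and Fatou's lemma passes to
the limit. -/
theorem RepresentsConvolution.eLpNorm_le {S₀ S₁ S₂ : Set E3} [SFinite (surfaceMeasure S₀)]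
    [SFinite (surfaceMeasure S₁)] [SFinite (surfaceMeasure S₂)] {M ε₀ : ℝ} (hε₀ : 0 < ε₀)
    (hM : 0 ≤ M) (hker : ∀ ε, 0 < ε → ε ≤ ε₀ → ∀ η : E3 → ℝ,
        (∀ v, η v ≤ 6 / (Real.pi * ε ^ 3)) → (∀ v, ε ≤ ‖v‖ → η v = 0) → ∀ x y : E3,
          ∫⁻ z : S₂, (∫⁻ p : S₁, ENNReal.ofReal (η (z - x - p)) ∂(surfaceMeasure S₁)) *
            ∫⁻ q : S₀, ENNReal.ofReal (η (z - y - q)) ∂(surfaceMeasure S₀)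
              ∂(surfaceMeasure S₂) ≤ ENNReal.ofReal M)
    {f : S₀ → ℂ} {g : S₁ → ℂ} {F : E3 → ℂ} (hf : Continuous f) (hg : Continuous g)
    (hF : Continuous F) (h : RepresentsConvolution f g F) :
    eLpNorm (fun z : S₂ => F z) 2 (surfaceMeasure S₂) ≤ ENNReal.ofReal √M *
      (eLpNorm f 2 (surfaceMeasure S₀) * eLpNorm g 2 (surfaceMeasure S₁)) := by
  set ε : ℕ → ℝ := fun k => ε₀ / (k + 1) with hεdef
  have hε : ∀ k, 0 < ε k := fun k => by positivity
  have hεle : ∀ k, ε k ≤ ε₀ := fun k => div_le_self hε₀.le (by linarith [k.cast_nonneg (α := ℝ)])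
  have hlim : Tendsto ε atTop (𝓝 0) := by
    have := (tendsto_one_div_add_atTop_nhds_zero_nat (𝕜 := ℝ)).const_mul ε₀
    rw [mul_zero] at this
    exact this.congr fun k => by rw [hεdef]; simp [div_eq_mul_inv]
  set G : ℕ → S₂ → ℂ := fun k z =>
    ∫ w, (mollifier (ε k) (hε k)).normed volume ((z : E3) - w) • F w with hG
  set Q : ℕ → S₂ → ℝ≥0∞ := fun k z => ∫⁻ w : S₀ × S₁, ‖f w.1‖ₑ * ‖g w.2‖ₑ *
        ENNReal.ofReal ((mollifier (ε k) (hε k)).normed volume ((z : E3) - w.1 - w.2))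
          ∂((surfaceMeasure S₀).prod (surfaceMeasure S₁)) with hQ
  have hQm : ∀ k, Measurable (Q k) := fun k => by
    refine Measurable.lintegral_prod_right ?_
    refine ((hf.comp (by fun_prop : Continuous fun v : S₂ × (S₀ × S₁) => v.2.1)).enorm.measurable.mul
      (hg.comp (by fun_prop : Continuous fun v : S₂ × (S₀ × S₁) => v.2.2)).enorm.measurable).mul ?_
    exact ENNReal.measurable_ofReal.comp
      ((mollifier (ε k) (hε k)).continuous_normed.comp (by fun_prop)).measurable
  have hbound : ∀ k, ∫⁻ z, Q k z ^ 2 ∂(surfaceMeasure S₂) ≤ ENNReal.ofReal M *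
      ((∫⁻ x, ‖f x‖ₑ ^ 2 ∂(surfaceMeasure S₀)) * ∫⁻ y, ‖g y‖ₑ ^ 2 ∂(surfaceMeasure S₁)) := fun k =>
    lintegral_sq_convolution_le
      (ENNReal.measurable_ofReal.comp (mollifier (ε k) (hε k)).continuous_normed.measurable)
      (hker (ε k) (hε k) (hεle k) _ (mollifier_normed_le (hε k)) (mollifier_normed_eq_zero (hε k)))
      hf.enorm.measurable hg.enorm.measurable
  have hle : ∀ z : S₂, ‖F z‖ₑ ^ 2 ≤ liminf (fun k => Q k z ^ 2) atTop := fun z => by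
    have h1 : Tendsto (fun k => ‖G k z‖ₑ ^ 2) atTop (𝓝 (‖F z‖ₑ ^ 2)) :=
      ((ENNReal.continuous_pow 2).tendsto _).comp (tendsto_mollified hF hε hlim z).enorm
    rw [← h1.liminf_eq]
    exact liminf_le_liminf (Eventually.of_forall fun k =>
      pow_le_pow_left' (enorm_mollified_le hf hg h (hε k) z) 2)
  have key : ∫⁻ z : S₂, ‖F z‖ₑ ^ 2 ∂(surfaceMeasure S₂) ≤ ENNReal.ofReal M *
      ((∫⁻ x, ‖f x‖ₑ ^ 2 ∂(surfaceMeasure S₀)) * ∫⁻ y, ‖g y‖ₑ ^ 2 ∂(surfaceMeasure S₁)) :=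
    calc _ ≤ _ := lintegral_mono hle
      _ ≤ _ := lintegral_liminf_le fun k => (hQm k).pow_const 2
      _ ≤ _ := liminf_le_of_le (by isBoundedDefault) fun b hb => by
        obtain ⟨k, hk⟩ := hb.exists
        exact hk.trans (hbound k)
  rw [← eLpNorm_two_sq, ← eLpNorm_two_sq, ← eLpNorm_two_sq] at key
  refine (ENNReal.pow_le_pow_left_iff two_ne_zero).1 (key.trans_eq ?_)
  rw [mul_pow, mul_pow, ← ENNReal.ofReal_pow (Real.sqrt_nonneg M), Real.sq_sqrt hM]

/-! ### Uniqueness, bilinearity and existence of the convolution -/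

theorem RepresentsConvolution.eq_of_continuous {S₁ S₂ : Set E3} {f : S₁ → ℂ} {g : S₂ → ℂ}
    {F G : E3 → ℂ} (hF : Continuous F) (hG : Continuous G) (h : RepresentsConvolution f g F)
    (h' : RepresentsConvolution f g G) : F = G := by
  refine (hF.ae_eq_iff_eq volume hG).1 ?_
  refine ae_eq_of_integral_contDiff_smul_eq hF.locallyIntegrable hG.locallyIntegrable ?_
  intro ψ hψ hψc
  have h1 := h (fun x => (ψ x : ℂ)) (Complex.ofRealCLM.contDiff.comp hψ)
    (hψc.comp_left (g := fun x : ℝ => (x : ℂ)) Complex.ofReal_zero)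
  have h2 := h' (fun x => (ψ x : ℂ)) (Complex.ofRealCLM.contDiff.comp hψ)
    (hψc.comp_left (g := fun x : ℝ => (x : ℂ)) Complex.ofReal_zero)
  simp only [Complex.real_smul, mul_comm (Complex.ofReal _)]
  rw [h1, h2]

section Bilinear

variable {S₁ S₂ : Set E3} [IsFiniteMeasure (surfaceMeasure S₁)]
  [IsFiniteMeasure (surfaceMeasure S₂)]

theorem integrable_convolution_integrand (f : C_c(S₁, ℂ)) (g : C_c(S₂, ℂ)) {ψ : E3 → ℂ}
    (hψ : Continuous ψ) :
    Integrable (fun w : S₁ × S₂ => f w.1 * g w.2 * ψ ((w.1 : E3) + (w.2 : E3)))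
      ((surfaceMeasure S₁).prod (surfaceMeasure S₂)) := by
  refine Continuous.integrable_of_hasCompactSupport ?_ ?_
  · exact ((f.continuous.comp continuous_fst).mul (g.continuous.comp continuous_snd)).mul
      (hψ.comp (by fun_prop))
  · refine HasCompactSupport.of_support_subset_isCompact
      (f.hasCompactSupport.isCompact.prod g.hasCompactSupport.isCompact) fun w hw => ?_
    constructor
    · refine subset_tsupport _ fun h0 => hw ?_
      simp [h0]
    · refine subset_tsupport _ fun h0 => hw ?_
      simp [h0]

theorem representsConvolution_iff (f : C_c(S₁, ℂ)) (g : C_c(S₂, ℂ)) (F : E3 → ℂ) :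
    RepresentsConvolution f g F ↔ ∀ ψ : E3 → ℂ, ContDiff ℝ ∞ ψ → HasCompactSupport ψ →
      ∫ z, F z * ψ z = ∫ w : S₁ × S₂, f w.1 * g w.2 * ψ ((w.1 : E3) + (w.2 : E3))
        ∂((surfaceMeasure S₁).prod (surfaceMeasure S₂)) := by
  refine forall₃_congr fun ψ hψ hψc => ?_
  rw [integral_prod _ (integrable_convolution_integrand f g hψ.continuous)]

/-- This is f₁ * g₁ - f₂ * g₂ = (f₁ - f₂) * g₁ + f₂ * (g₁ - g₂), pointwise because continuous
representatives are unique. -/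
theorem RepresentsConvolution.combine {f₁ f₂ : C_c(S₁, ℂ)} {g₁ g₂ : C_c(S₂, ℂ)}
    {F₁ F₂ G₁ G₂ : C_c(E3, ℂ)}
    (h₁ : RepresentsConvolution f₁ g₁ F₁) (h₂ : RepresentsConvolution f₂ g₂ F₂)
    (h₃ : RepresentsConvolution (f₁ - f₂) g₁ G₁) (h₄ : RepresentsConvolution f₂ (g₁ - g₂) G₂) :
    ∀ z, F₁ z - F₂ z = G₁ z + G₂ z := by
  have hsum : RepresentsConvolution f₁ g₁ fun z => G₁ z + G₂ z + F₂ z := by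
    rw [representsConvolution_iff]
    intro ψ hψ hψc
    have e2 := (representsConvolution_iff f₂ g₂ _).1 h₂ ψ hψ hψc
    have e3 := (representsConvolution_iff (f₁ - f₂) g₁ _).1 h₃ ψ hψ hψc
    have e4 := (representsConvolution_iff f₂ (g₁ - g₂) _).1 h₄ ψ hψ hψc
    have hint : ∀ F : C_c(E3, ℂ), Integrable fun z => F z * ψ z := fun F =>
      (F.continuous.mul hψ.continuous).integrable_of_hasCompactSupport F.hasCompactSupport.mul_right
    have i₁ : Integrable fun z => G₁ z * ψ z + G₂ z * ψ z := (hint G₁).add (hint G₂)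
    have i₂ := integrable_convolution_integrand (f₁ - f₂) g₁ hψ.continuous
    have i₃ := integrable_convolution_integrand f₂ (g₁ - g₂) hψ.continuous
    have i₄ := integrable_convolution_integrand f₂ g₂ hψ.continuous
    have i₅ : Integrable (fun w : S₁ × S₂ => (f₁ - f₂) w.1 * g₁ w.2 * ψ ((w.1 : E3) + (w.2 : E3)) +
        f₂ w.1 * (g₁ - g₂) w.2 * ψ ((w.1 : E3) + (w.2 : E3)))
        ((surfaceMeasure S₁).prod (surfaceMeasure S₂)) := i₂.add i₃
    simp only [add_mul]
    rw [integral_add i₁ (hint F₂), integral_add (hint G₁) (hint G₂), e2, e3, e4,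
      ← integral_add i₂ i₃, ← integral_add i₅ i₄]
    congr 1
    ext w
    simp only [CompactlySupportedContinuousMap.coe_sub, Pi.sub_apply]
    ring
  intro z
  have hz : F₁ z = G₁ z + G₂ z + F₂ z := congrFun (h₁.eq_of_continuous F₁.continuous
    ((G₁.continuous.add G₂.continuous).add F₂.continuous) hsum) z
  rw [hz]
  ring

/-- Existence of the convolution as a continuous function from local densities. -/
theorem exists_representsConvolution [LocallyCompactSpace S₁] [LocallyCompactSpace S₂]
    (h : ∀ x : S₁ × S₂, ∃ W, IsOpen W ∧ x ∈ W ∧ ∀ H : S₁ × S₂ → ℂ, Continuous H →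
      HasCompactSupport H → tsupport H ⊆ W →
        HasSumDensity (surfaceMeasure S₁) (surfaceMeasure S₂) H)
    (f : C_c(S₁, ℂ)) (g : C_c(S₂, ℂ)) : ∃ F : C_c(E3, ℂ), RepresentsConvolution f g F := by
  obtain ⟨F, hF, hFc, hFi⟩ := hasSumDensity_of_locally h
    (H := fun w : S₁ × S₂ => f w.1 * g w.2)
    ((f.continuous.comp continuous_fst).mul (g.continuous.comp continuous_snd)) (by
      refine HasCompactSupport.of_support_subset_isCompact
        (f.hasCompactSupport.isCompact.prod g.hasCompactSupport.isCompact) fun w hw => ?_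
      exact ⟨subset_tsupport _ (left_ne_zero_of_mul hw), subset_tsupport _ (right_ne_zero_of_mul hw)⟩)
  refine ⟨⟨⟨F, hF⟩, hFc⟩, ?_⟩
  rw [representsConvolution_iff]
  exact fun ψ hψ hψc => (hFi ψ hψ.continuous).symm

end Bilinear

/-! ### Extension to L² by density -/

section Trace

variable {S₀ S₁ S₂ : Set E3}

theorem memLp_compactlySupported {S : Set E3} [IsFiniteMeasure (surfaceMeasure S)]
    (φ : C_c(S, ℂ)) : MemLp φ 2 (surfaceMeasure S) :=
  φ.continuous.memLp_of_hasCompactSupport φ.hasCompactSupport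

theorem memLp_restriction {S : Set E3} [IsFiniteMeasure (surfaceMeasure S)]
    (F : C_c(E3, ℂ)) : MemLp (fun z : S => F z) 2 (surfaceMeasure S) := by
  obtain ⟨c, hc⟩ := F.hasCompactSupport.exists_bound_of_continuous F.continuous
  exact MemLp.of_bound (F.continuous.comp continuous_subtype_val).aestronglyMeasurable c
    (ae_of_all _ fun z => hc z)

theorem tendsto_toLp_iff {S : Set E3} {u : ℕ → S → ℂ}
    (hu : ∀ k, MemLp (u k) 2 (surfaceMeasure S)) (f : Lp ℂ 2 (surfaceMeasure S)) :
    Tendsto (fun k => (hu k).toLp (u k)) atTop (𝓝 f) ↔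
      Tendsto (fun k => eLpNorm (fun x => u k x - f x) 2 (surfaceMeasure S)) atTop (𝓝 0) := by
  have := Lp.tendsto_Lp_iff_tendsto_eLpNorm'' (fi := atTop) u hu f (Lp.memLp f)
  rwa [Lp.toLp_coeFn] at this

theorem exists_tendsto_compactlySupported {S : Set E3} [IsFiniteMeasure (surfaceMeasure S)]
    [LocallyCompactSpace S] (f : Lp ℂ 2 (surfaceMeasure S)) :
    ∃ φ : ℕ → C_c(S, ℂ),
      Tendsto (fun k => (memLp_compactlySupported (φ k)).toLp (φ k)) atTop (𝓝 f) := by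
  have h : ∀ k : ℕ, ∃ φ : C_c(S, ℂ), eLpNorm (fun x => φ x - f x) 2 (surfaceMeasure S) ≤
      ((k : ℝ≥0∞) + 1)⁻¹ := by
    intro k
    obtain ⟨φ, hφ, hle, hc, -⟩ := (Lp.memLp f).exists_hasCompactSupport_eLpNorm_sub_le
      (by norm_num) (ε := ((k : ℝ≥0∞) + 1)⁻¹) (by simp)
    refine ⟨⟨⟨φ, hc⟩, hφ⟩, ?_⟩
    rw [eLpNorm_sub_comm] at hle
    exact hle
  choose φ hφ using h
  refine ⟨φ, (tendsto_toLp_iff _ f).2 ?_⟩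
  refine tendsto_of_tendsto_of_tendsto_of_le_of_le tendsto_const_nhds ?_ (fun k => zero_le) hφ
  have := (tendsto_add_atTop_iff_nat 1).2 ENNReal.tendsto_inv_nat_nhds_zero
  simpa using this

/-- A bound for the restricted convolution of compactly supported functions gives the existence,
uniqueness and boundedness of the restriction of the convolution of `L²` functions. -/
theorem exists_convolutionTrace [IsFiniteMeasure (surfaceMeasure S₀)]
    [IsFiniteMeasure (surfaceMeasure S₁)] [IsFiniteMeasure (surfaceMeasure S₂)]
    [LocallyCompactSpace S₀] [LocallyCompactSpace S₁] {K : ℝ} (hK : 0 ≤ K)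
    (hex : ∀ (φ : C_c(S₀, ℂ)) (γ : C_c(S₁, ℂ)),
      ∃ F : C_c(E3, ℂ), RepresentsConvolution φ γ F)
    (hbd : ∀ (φ : C_c(S₀, ℂ)) (γ : C_c(S₁, ℂ)) (F : C_c(E3, ℂ)), RepresentsConvolution φ γ F →
      eLpNorm (fun z : S₂ => F z) 2 (surfaceMeasure S₂) ≤ ENNReal.ofReal K *
        (eLpNorm φ 2 (surfaceMeasure S₀) * eLpNorm γ 2 (surfaceMeasure S₁)))
    (f : Lp ℂ 2 (surfaceMeasure S₀)) (g : Lp ℂ 2 (surfaceMeasure S₁)) :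
    ∃ h : Lp ℂ 2 (surfaceMeasure S₂), IsConvolutionTrace f g h ∧
      (∀ h' : Lp ℂ 2 (surfaceMeasure S₂), IsConvolutionTrace f g h' → h' = h) ∧
      ‖h‖ ≤ K * ‖f‖ * ‖g‖ := by
  set ι₀ : C_c(S₀, ℂ) → Lp ℂ 2 (surfaceMeasure S₀) :=
    fun φ => (memLp_compactlySupported φ).toLp φ with hι₀
  set ι₁ : C_c(S₁, ℂ) → Lp ℂ 2 (surfaceMeasure S₁) :=
    fun φ => (memLp_compactlySupported φ).toLp φ with hι₁
  set ρ : C_c(E3, ℂ) → Lp ℂ 2 (surfaceMeasure S₂) :=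
    fun F => (memLp_restriction F).toLp fun z : S₂ => F z with hρ
  have hι₀_sub : ∀ φ φ', ι₀ (φ - φ') = ι₀ φ - ι₀ φ' := fun φ φ' =>
    MemLp.toLp_sub (memLp_compactlySupported φ) (memLp_compactlySupported φ')
  have hι₁_sub : ∀ φ φ', ι₁ (φ - φ') = ι₁ φ - ι₁ φ' := fun φ φ' =>
    MemLp.toLp_sub (memLp_compactlySupported φ) (memLp_compactlySupported φ')
  have hnorm : ∀ (φ : C_c(S₀, ℂ)) (γ : C_c(S₁, ℂ)) (F : C_c(E3, ℂ)), RepresentsConvolution φ γ F → ‖ρ F‖ ≤ K * (‖ι₀ φ‖ * ‖ι₁ γ‖) := by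
    intro φ γ F hF
    simp only [hρ, hι₀, hι₁, Lp.norm_toLp]
    rw [← ENNReal.toReal_ofReal hK, ← ENNReal.toReal_mul, ← ENNReal.toReal_mul]
    refine ENNReal.toReal_mono ?_ (hbd φ γ F hF)
    exact ENNReal.mul_ne_top ENNReal.ofReal_ne_top
      (ENNReal.mul_ne_top (memLp_compactlySupported φ).2.ne (memLp_compactlySupported γ).2.ne)
  have hlip : ∀ (φ φ' : C_c(S₀, ℂ)) (γ γ' : C_c(S₁, ℂ)) (F F' : C_c(E3, ℂ)),
      RepresentsConvolution φ γ F → RepresentsConvolution φ' γ' F' →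
      dist (ρ F) (ρ F') ≤
        K * (‖ι₀ φ - ι₀ φ'‖ * ‖ι₁ γ‖) + K * (‖ι₀ φ'‖ * ‖ι₁ γ - ι₁ γ'‖) := by
    intro φ φ' γ γ' F F' hF hF'
    obtain ⟨G, hG⟩ := hex (φ - φ') γ
    obtain ⟨G', hG'⟩ := hex φ' (γ - γ')
    have e : ρ F - ρ F' = ρ G + ρ G' := by
      simp only [hρ]
      rw [← MemLp.toLp_sub, ← MemLp.toLp_add]
      exact MemLp.toLp_congr _ _ (ae_of_all _ fun z =>
        RepresentsConvolution.combine hF hF' hG hG' z)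
    rw [dist_eq_norm, e, ← hι₀_sub, ← hι₁_sub]
    exact (norm_add_le _ _).trans (add_le_add (hnorm _ _ _ hG) (hnorm _ _ _ hG'))
  -- The filter is kept general to serve twice: on ℕ × ℕ it shows that the restrictions are Cauchy,
  -- and on ℕ that the limit does not depend on the approximating sequences.
  have hlim : ∀ {α : Type} {l : Filter α} {φ φ' : α → C_c(S₀, ℂ)} {γ γ' : α → C_c(S₁, ℂ)}
      {F F' : α → C_c(E3, ℂ)}, Tendsto (fun k => ι₀ (φ k)) l (𝓝 f) →
      Tendsto (fun k => ι₀ (φ' k)) l (𝓝 f) → Tendsto (fun k => ι₁ (γ k)) l (𝓝 g) →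
      Tendsto (fun k => ι₁ (γ' k)) l (𝓝 g) → (∀ k, RepresentsConvolution (φ k) (γ k) (F k)) →
      (∀ k, RepresentsConvolution (φ' k) (γ' k) (F' k)) →
      Tendsto (fun k => dist (ρ (F k)) (ρ (F' k))) l (𝓝 0) := by
    intro α l φ φ' γ γ' F F' h₁ h₂ h₃ h₄ h₅ h₆
    refine squeeze_zero (fun _ => dist_nonneg) (fun k => hlip _ _ _ _ _ _ (h₅ k) (h₆ k)) ?_
    have := (((h₁.sub h₂).norm.mul h₃.norm).const_mul K).add
      ((h₂.norm.mul (h₃.sub h₄).norm).const_mul K)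
    simpa using this
  obtain ⟨φ, hφ⟩ := exists_tendsto_compactlySupported f
  obtain ⟨γ, hγ⟩ := exists_tendsto_compactlySupported g
  choose F hF using fun k => hex (φ k) (γ k)
  have hcauchy : CauchySeq fun k => ρ (F k) := by
    rw [cauchySeq_iff_tendsto_dist_atTop_0, ← prod_atTop_atTop_eq]
    exact hlim (φ := fun k : ℕ × ℕ => φ k.1) (φ' := fun k => φ k.2) (γ := fun k => γ k.1)
      (γ' := fun k => γ k.2) (F := fun k => F k.1) (F' := fun k => F k.2)
      (hφ.comp tendsto_fst) (hφ.comp tendsto_snd)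
      (hγ.comp tendsto_fst) (hγ.comp tendsto_snd) (fun k => hF k.1) fun k => hF k.2
  obtain ⟨h, hh⟩ := cauchySeq_tendsto_of_complete hcauchy
  refine ⟨h, ?_, ?_, ?_⟩
  · intro φ' γ' F' hφ' hγ' hF'
    rw [← tendsto_toLp_iff (fun k => memLp_compactlySupported (φ' k))] at hφ'
    rw [← tendsto_toLp_iff (fun k => memLp_compactlySupported (γ' k))] at hγ'
    rw [← tendsto_toLp_iff (u := fun k (z : S₂) => F' k z) (fun k => memLp_restriction (F' k))]
    exact hh.congr_dist (hlim hφ hφ' hγ hγ' hF hF')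
  · intro h' hh'
    have := hh' φ γ F ((tendsto_toLp_iff _ f).1 hφ) ((tendsto_toLp_iff _ g).1 hγ) hF
    rw [← tendsto_toLp_iff (u := fun k (z : S₂) => F k z) (fun k => memLp_restriction (F k))]
      at this
    exact tendsto_nhds_unique this hh
  · rw [mul_assoc]
    exact le_of_tendsto_of_tendsto' hh.norm ((hφ.norm.mul hγ.norm).const_mul K)
      fun k => hnorm _ _ _ (hF k)

end Trace

/-! ### Conclusion -/

theorem linearIndependent_of_det_ne_zero {u : Fin 3 → E3}
    (h : (Matrix.of fun k i : Fin 3 => u i k).det ≠ 0) :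
    LinearIndependent ℝ ![u 0, u 1] := by
  rw [LinearIndependent.pair_iff]
  intro s t hst
  have h0 : ∀ k, s * u 0 k + t * u 1 k = 0 := fun k => by
    simpa using congrArg (fun v : E3 => v k) hst
  rw [det_of_columns] at h
  constructor
  · refine (mul_eq_zero.1 ?_).resolve_right h
    linear_combination (u 1 1 * u 2 2 - u 2 1 * u 1 2) * h0 0 -
      (u 1 0 * u 2 2 - u 2 0 * u 1 2) * h0 1 + (u 1 0 * u 2 1 - u 2 0 * u 1 1) * h0 2
  · refine (mul_eq_zero.1 ?_).resolve_right h
    linear_combination -(u 0 1 * u 2 2 - u 2 1 * u 0 2) * h0 0 +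
      (u 0 0 * u 2 2 - u 2 0 * u 0 2) * h0 1 - (u 0 0 * u 2 1 - u 2 0 * u 0 1) * h0 2

theorem mainTheorem3 (β : ℝ) (hβ_pos : 0 < β) (hβ_le : β ≤ 1) :
    ∃ C : ℝ, ∀ (b θ R : ℝ) (S : Fin 3 → Set E3), 0 < b → 0 < θ →
      TransversalSurfaces β b θ S → (∀ i, Metric.diam (S i) ≤ R) → R ^ β * b ≤ θ →
      (∀ (φ : C_c(S 0, ℂ)) (γ : C_c(S 1, ℂ)),
        ∃ F : C_c(E3, ℂ), RepresentsConvolution φ γ F) ∧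
      (∀ (f : Lp ℂ 2 (surfaceMeasure (S 0))) (g : Lp ℂ 2 (surfaceMeasure (S 1))),
        ∃ h : Lp ℂ 2 (surfaceMeasure (S 2)),
          IsConvolutionTrace f g h ∧
          (∀ h' : Lp ℂ 2 (surfaceMeasure (S 2)), IsConvolutionTrace f g h' → h' = h) ∧
          ‖h‖ ≤ C / Real.sqrt θ * ‖f‖ * ‖g‖) := by
  obtain ⟨M, hM, hker⟩ := exists_kernel_bound β hβ_pos hβ_le
  refine ⟨√M, fun b θ R S hb hθ hS hR hRb => ?_⟩
  obtain ⟨Sstar, n, hsurf, hdet⟩ := hS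
  have hfin : ∀ i, IsFiniteMeasure (surfaceMeasure (S i)) := fun i =>
    (hsurf i).isFiniteMeasure hb hβ_pos
  have hlc : ∀ i, LocallyCompactSpace (S i) := fun i => (hsurf i).locallyCompactSpace
  choose p hp using fun i => (hsurf i).nonempty
  have hps : ∀ i, p i ∈ Sstar i := fun i => (hsurf i).subset (hp i)
  -- The surfaces are nonempty, so some triple of points realizes θ ≤ det ≤ 1.
  have hθ1 : θ ≤ 1 := (hdet p hps).1.trans (hdet p hps).2
  obtain ⟨ε₀, hε₀, hε⟩ := hker b θ R S Sstar n hsurf (fun x hx => (hdet x hx).1) hb hθ hθ1 (hR 2)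
    hRb
  have hex : ∀ (φ : C_c(S 0, ℂ)) (γ : C_c(S 1, ℂ)),
      ∃ F : C_c(E3, ℂ), RepresentsConvolution φ γ F := by
    refine exists_representsConvolution fun x =>
      exists_nhds_hasSumDensity (hsurf 0) (hsurf 1) x ?_
    refine linearIndependent_of_det_ne_zero
      (u := ![n 0 x.1, n 1 x.2, n 2 (p 2)]) (hθ.trans_le ?_).ne'
    have hx := (hdet ![(x.1 : E3), x.2, p 2] fun i => by
      fin_cases i
      · exact (hsurf 0).subset x.1.2
      · exact (hsurf 1).subset x.2.2
      · exact hps 2).1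
    rw [det_of_columns] at hx ⊢
    exact hx
  refine ⟨hex, ?_⟩
  rw [← Real.sqrt_div hM]
  exact exists_convolutionTrace (Real.sqrt_nonneg _) hex fun φ γ F hF =>
    hF.eLpNorm_le hε₀ (div_nonneg hM hθ.le) hε φ.continuous γ.continuous F.continuous
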